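/- Let $n\ge 1$, $N=2n$, $i'=2n+1-i$, $\xi=-q^{-2n}$, $(\bar 1,\dots,\overline{2n})=(n-1,\dots,1,0,0,-1,\dots,-n+1)$, and let $e_{ij}\in\operatorname{End}\mathbb C^{2n}$ be the matrix units. Put $$\overline R^{[n]}(u)=\sum_{i}e_{ii}\otimes e_{ii}+\frac{u-1}{qu-q^{-1}}\sum_{i\ne j,j'}e_{ii}\otimes e_{jj}+\frac{q-q^{-1}}{qu-q^{-1}}\sum_{i>j,\,i\ne j'}e_{ij}\otimes e_{ji}+\frac{(q-q^{-1})u}{qu-q^{-1}}\sum_{i<j,\,i\ne j'}e_{ij}\otimes e_{ji}+\frac{1}{(u-q^{-2})(u-\xi)}\sum_{i,j}a_{ij}(u)\,e_{i'j'}\otimes e_{ij},$$ where $a_{ii}(u)=(q^{-2}u-\xi)(u-1)$, $a_{ij}(u)=(q^{-2}-1)\big(q^{\bar i-\bar j}\xi(u-1)-\delta_{ij'}(u-\xi)\big)$ for $i<j$, and $a_{ij}(u)=(q^{-2}-1)u\big(q^{\bar i-\bar j}(u-1)-\delta_{ij'}(u-\xi)\big)$ for $i>j$. Let $U(\overline R^{[n]})$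 be the unital associative $\mathbb C(q)$-algebra generated by an invertible central element $q^{c/2}$ and elements $\ell^{\pm}_{ij}[\mp a]$ ($1\le i,j\le 2n$, $a\ge 0$) with the relations $\ell^+_{ij}[0]=\ell^-_{ji}[0]=0$ for $i<j$, $\ell^+_{nn}[0]\,\ell^+_{n+1,n+1}[0]=1$, $\ell^+_{ii}[0]\ell^-_{ii}[0]=\ell^-_{ii}[0]\ell^+_{ii}[0]=1$, and $$\overline R^{[n]}(u/v)\mathcal L^{\pm}_1(u)\mathcal L^{\pm}_2(v)=\mathcal L^{\pm}_2(v)\mathcal L^{\pm}_1(u)\overline R^{[n]}(u/v),\qquad \overline R^{[n]}(uq^{c}/v)\mathcal L^{+}_1(u)\mathcal L^{-}_2(v)=\mathcal L^{-}_2(v)\mathcal L^{+}_1(u)\overline R^{[n]}(uq^{-c}/v),$$ where $\ell^{\pm}_{ij}(u)=\sum_{a\ge0}\ell^{\pm}_{ij}[\mp a]u^{\pm a}$, $\mathcal L^{\pm}_1(u)=\sum e_{ij}\otimes1\otimes\ell^{\pm}_{ij}(u)$, $\mathcal L^{\pm}_2(u)=\sum 1\otimes e_{ij}\otimes\ell^{\pm}_{ij}(u)$,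 and the entries of $\overline R^{[n]}$ are expanded in nonnegative powers of $u/v$. For a square matrix $A$ over a ring, let $A^{ij}$ be $A$ with row $i$ and column $j$ deleted; if $A^{ij}$ is invertible, the $(i,j)$ quasideterminant of $A$ is $|A|_{ij}=a_{ij}-r_i^j(A^{ij})^{-1}c_j^i$, where $r_i^j$ is the $i$-th row of $A$ without $a_{ij}$ and $c_j^i$ is the $j$-th column without $a_{ij}$. It is also written by boxing $a_{ij}$. Let $0\le m\le n-1$ and label the indices of the generators of $U(\overline R^{[n-m]})$ by $m+1,\dots,(m+1)'=2n-m$. Then the matrices $[\ell^{\pm}_{ab}(u)]_{1\le a,b\le m}$ over $U(\overline R^{[n]})[[u^{\pm1}]]$ are invertible, and the assignment $q^{\pm c/2}\mapsto q^{\pm c/2}$, $$\ell^{\pm}_{ij}(u)\mapsto\begin{vmatrix}\ell^{\pm}_{11}(u)&\dots&\ell^{\pm}_{1m}(u)&\ell^{\pm}_{1j}(u)\\ \dots&\dots&\dots&\dots\\ \ell^{\pm}_{m1}(u)&\dots&\ell^{\pm}_{mm}(u)&\ell^{\pm}_{mj}(u)\\ \ell^{\pm}_{i1}(u)&\dots&\ell^{\pm}_{im}(u)&\boxed{\ell^{\pm}_{ij}(u)}\end{vmatrix},\qquad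 m+1\le i,j\le (m+1)',$$ defines a (unique) homomorphism of $\mathbb C(q)$-algebras $\psi^{(n)}_m:U(\overline R^{[n-m]})\to U(\overline R^{[n]})$. Moreover, for $l,m\ge0$ with $l+m\le n-1$, $$\psi^{(n)}_l\circ\psi^{(n-l)}_m=\psi^{(n)}_{l+m}.$$ -/

import Mathlib

open scoped PowerSeries Kronecker

noncomputable section

namespace TwistedRTT

/-! ### Quasideterminants -/

/-- The `(i, j)` quasideterminant `a_{ij} - r_i^j (A^{ij})⁻¹ c_j^i` of a square matrix over a ring,
where `A^{ij}` is `A` without row `i` and column `j`. It is meant for invertible `A^{ij}`;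
`Ring.inverse` is the two-sided inverse in the matrix ring. -/
def quasidet {S : Type*} [Ring S] {m : ℕ} (A : Matrix (Fin (m + 1)) (Fin (m + 1)) S)
    (i j : Fin (m + 1)) : S :=
  A i j - ∑ b : Fin m, ∑ a : Fin m,
    A i (j.succAbove b) *
      (Ring.inverse (A.submatrix i.succAbove j.succAbove) : Matrix (Fin m) (Fin m) S) b a *
      A (i.succAbove a) j

/-! ### The R-matrix -/

section RMatrix

variable {K : Type*} [Field K]

/-- `(n - 1, n - 2, …, 0, 0, …, -n + 1)`, with indices running from `0` to `2 n - 1`. -/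
def bar (n : ℕ) (i : Fin (2 * n)) : ℤ :=
  if (i : ℕ) < n then (n : ℤ) - 1 - (i : ℕ) else (n : ℤ) - (i : ℕ)

/-- `ξ = -q^{-2n}`. -/
def xi (q : K) (n : ℕ) : K := -(q ^ (-(2 * (n : ℤ))))

/-- The series `a_{ij}(u)`; here `u` is `PowerSeries.X` and `i' = Fin.rev i`. -/
def aCoeff (q : K) (n : ℕ) (i j : Fin (2 * n)) : K⟦X⟧ :=
  let u : K⟦X⟧ := PowerSeries.X
  let c : K → K⟦X⟧ := fun x => PowerSeries.C x
  let δ : K⟦X⟧ := if i = j.rev then 1 else 0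
  if i = j then (c (q ^ (-2 : ℤ)) * u - c (xi q n)) * (u - 1)
  else if i < j then
    c (q ^ (-2 : ℤ) - 1) *
      (c (q ^ (bar n i - bar n j)) * c (xi q n) * (u - 1) - δ * (u - c (xi q n)))
  else
    c (q ^ (-2 : ℤ) - 1) * u *
      (c (q ^ (bar n i - bar n j)) * (u - 1) - δ * (u - c (xi q n)))

/-- The matrix unit `e_{ij}`. -/
def mu (K : Type*) [Field K] (n : ℕ) (i j : Fin (2 * n)) :
    Matrix (Fin (2 * n)) (Fin (2 * n)) K⟦X⟧ :=
  Matrix.single i j 1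

/-- The matrix `R̄(u)`, each entry expanded as a power series in `u` (for `q ≠ 0` all
denominators have a nonzero constant term). The coefficient of `e_{ij} ⊗ e_{kl}` is the entry
in row `(i, k)` and column `(j, l)`. -/
def Rbar (q : K) (n : ℕ) :
    Matrix (Fin (2 * n) × Fin (2 * n)) (Fin (2 * n) × Fin (2 * n)) K⟦X⟧ :=
  let u : K⟦X⟧ := PowerSeries.X
  let c : K → K⟦X⟧ := fun x => PowerSeries.C x
  (∑ i, mu K n i i ⊗ₖ mu K n i i)
  + ((u - 1) * (c q * u - c q⁻¹)⁻¹) •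
      (∑ i, ∑ j, if i ≠ j ∧ i ≠ j.rev then mu K n i i ⊗ₖ mu K n j j else 0)
  + (c (q - q⁻¹) * (c q * u - c q⁻¹)⁻¹) •
      (∑ i, ∑ j, if j < i ∧ i ≠ j.rev then mu K n i j ⊗ₖ mu K n j i else 0)
  + (c (q - q⁻¹) * u * (c q * u - c q⁻¹)⁻¹) •
      (∑ i, ∑ j, if i < j ∧ i ≠ j.rev then mu K n i j ⊗ₖ mu K n j i else 0)
  + ((u - c (q ^ (-2 : ℤ))) * (u - c (xi q n)))⁻¹ •
      (∑ i, ∑ j, aCoeff q n i j • (mu K n i.rev j.rev ⊗ₖ mu K n i j))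

end RMatrix

/-! ### The algebra `U(R̄)` -/

/-- The superscript `±`. -/
inductive Sgn
  | plus
  | minus

/-- Generators: `qHalf` is `q^{c/2}`, `qHalfInv` its inverse, `ell s i j a` is
`ℓ⁺_{ij}[-a]` for `s = plus` and `ℓ⁻_{ij}[a]` for `s = minus`. -/
inductive Gen (n : ℕ)
  | qHalf
  | qHalfInv
  | ell (s : Sgn) (i j : Fin (2 * n)) (a : ℕ)

section Algebra

variable {K : Type*} [Field K]

/-- The coefficient of `u^a`, `a ∈ ℤ`, in `∑_{k ≥ 0} g k u^k` for `s = plus` and in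
`∑_{k ≥ 0} g k u^{-k}` for `s = minus`. -/
def zcoeff {A : Type*} [Zero A] (s : Sgn) (g : ℕ → A) (a : ℤ) : A :=
  match s with
  | .plus => if 0 ≤ a then g a.toNat else 0
  | .minus => if a ≤ 0 then g (-a).toNat else 0

/-- The coefficient of `u^a v^b` in `f(z u / v) F(u, v)`, where `F(u, v) = ∑ F a b u^a v^b`.
It is used only for `F` such that the sum over `t` is finite. -/
def actCoeff {A : Type*} [Ring A] [Algebra K A] (f : K⟦X⟧) (z : A) (F : ℤ → ℤ → A)
    (a b : ℤ) : A :=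
  ∑ᶠ t : ℕ, PowerSeries.coeff t f • (z ^ t * F (a - t) (b + t))

/-- The coefficient of `u^a v^b` in the entry in row `(i, k)` and column `(j, l)` of
`R̄(z u / v) X₁(u) Y₂(v)`, for matrices of formal series `X`, `Y` given by coefficients. -/
def rttLeft {A : Type*} [Ring A] [Algebra K A] (q : K) (n : ℕ) (z : A)
    (X Y : Fin (2 * n) → Fin (2 * n) → ℤ → A) (i k j l : Fin (2 * n)) (a b : ℤ) : A :=
  ∑ p, ∑ r, actCoeff (Rbar q n (i, k) (p, r)) z (fun a b => X p j a * Y r l b) a b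

/-- The coefficient of `u^a v^b` in the entry in row `(i, k)` and column `(j, l)` of
`Y₂(v) X₁(u) R̄(z u / v)`. -/
def rttRight {A : Type*} [Ring A] [Algebra K A] (q : K) (n : ℕ) (z : A)
    (X Y : Fin (2 * n) → Fin (2 * n) → ℤ → A) (i k j l : Fin (2 * n)) (a b : ℤ) : A :=
  ∑ p, ∑ r, actCoeff (Rbar q n (p, r) (j, l)) z (fun a b => Y k r b * X i p a) a b

/-- The free generator attached to `g`. -/
def fgen (K : Type*) [Field K] {n : ℕ} (g : Gen n) : FreeAlgebra K (Gen n) :=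
  FreeAlgebra.ι K g

/-- The coefficient of `u^a` in the free generating series `ℓ^s_{ij}(u)`, `a ∈ ℤ`. -/
def fell (K : Type*) [Field K] {n : ℕ} (s : Sgn) (i j : Fin (2 * n)) (a : ℤ) :
    FreeAlgebra K (Gen n) :=
  zcoeff s (fun k => fgen K (Gen.ell s i j k)) a

/-- The defining relations of `U(R̄^{[n]})`. -/
inductive Rel (q : K) (n : ℕ) : FreeAlgebra K (Gen n) → FreeAlgebra K (Gen n) → Prop
  | qHalf_mul_inv : Rel q n (fgen K .qHalf * fgen K .qHalfInv) 1
  | qHalf_inv_mul : Rel q n (fgen K .qHalfInv * fgen K .qHalf) 1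
  | qHalf_central (g : Gen n) : Rel q n (fgen K .qHalf * fgen K g) (fgen K g * fgen K .qHalf)
  | plus_zero (i j : Fin (2 * n)) (h : i < j) : Rel q n (fgen K (.ell .plus i j 0)) 0
  | minus_zero (i j : Fin (2 * n)) (h : i < j) : Rel q n (fgen K (.ell .minus j i 0)) 0
  | middle (i j : Fin (2 * n)) (hi : (i : ℕ) + 1 = n) (hj : (j : ℕ) = n) :
      Rel q n (fgen K (.ell .plus i i 0) * fgen K (.ell .plus j j 0)) 1
  | plus_mul_minus (i : Fin (2 * n)) :
      Rel q n (fgen K (.ell .plus i i 0) * fgen K (.ell .minus i i 0)) 1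
  | minus_mul_plus (i : Fin (2 * n)) :
      Rel q n (fgen K (.ell .minus i i 0) * fgen K (.ell .plus i i 0)) 1
  | rtt_same (s : Sgn) (i k j l : Fin (2 * n)) (a b : ℤ) :
      Rel q n (rttLeft q n 1 (fell K s) (fell K s) i k j l a b)
        (rttRight q n 1 (fell K s) (fell K s) i k j l a b)
  | rtt_mixed (i k j l : Fin (2 * n)) (a b : ℤ) :
      Rel q n (rttLeft q n (fgen K .qHalf ^ 2) (fell K .plus) (fell K .minus) i k j l a b)
        (rttRight q n (fgen K .qHalfInv ^ 2) (fell K .plus) (fell K .minus) i k j l a b)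

/-- The algebra `U(R̄^{[n]})` over `K`. -/
abbrev URbar (q : K) (n : ℕ) : Type _ := RingQuot (Rel q n)

/-- The image of a generator in `U(R̄^{[n]})`. -/
def gen (q : K) {n : ℕ} (g : Gen n) : URbar q n :=
  RingQuot.mkAlgHom K (Rel q n) (fgen K g)

/-- The series `ℓ^±_{ij}(u)`: a power series in `u` for the sign `+`, in `u⁻¹` for `-`. -/
def lser (q : K) {n : ℕ} (s : Sgn) (i j : Fin (2 * n)) : (URbar q n)⟦X⟧ :=
  PowerSeries.mk fun a => gen q (.ell s i j a)

/-! ### The reduction maps -/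

/-- The `m` first indices among the `2 n` ones, where `r + m = n`. -/
def firstIdx {r m n : ℕ} (h : r + m = n) (a : Fin m) : Fin (2 * n) :=
  ⟨a, by have := a.isLt; omega⟩

/-- The labelling of the indices of `U(R̄^{[r]})`, `r = n - m`, by `m + 1, …, (m + 1)'`. -/
def shiftIdx {r m n : ℕ} (h : r + m = n) (i : Fin (2 * r)) : Fin (2 * n) :=
  ⟨m + i, by have := i.isLt; omega⟩

/-- The `m × m` matrix formed by the first `m` rows and columns of `ℒ^±(u)`. -/
def leadingBlock (q : K) {r m n : ℕ} (h : r + m = n) (s : Sgn) :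
    Matrix (Fin m) (Fin m) (URbar q n)⟦X⟧ :=
  Matrix.of fun a b => lser q s (firstIdx h a) (firstIdx h b)

/-- The `(m + 1) × (m + 1)` matrix formed by the rows `1, …, m, i` and the columns
`1, …, m, j` of `ℒ^±(u)`. -/
def borderedBlock (q : K) {r m n : ℕ} (h : r + m = n) (s : Sgn) (i j : Fin (2 * n)) :
    Matrix (Fin (m + 1)) (Fin (m + 1)) (URbar q n)⟦X⟧ :=
  Matrix.of fun a b =>
    lser q s (Fin.snoc (α := fun _ => Fin (2 * n)) (firstIdx h) i a)
      (Fin.snoc (α := fun _ => Fin (2 * n)) (firstIdx h) j b)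

/-- `ψ` fixes `q^{c/2}` and sends every coefficient of `ℓ^±_{ij}(u)` to that of the
quasideterminant of the bordered matrix with respect to its last entry. -/
def IsReduction (q : K) {r m n : ℕ} (h : r + m = n) (ψ : URbar q r →ₐ[K] URbar q n) : Prop :=
  ψ (gen q .qHalf) = gen q .qHalf ∧
  ∀ (s : Sgn) (i j : Fin (2 * r)),
    PowerSeries.map (ψ : URbar q r →+* URbar q n) (lser q s i j) =
      quasidet (borderedBlock q h s (shiftIdx h i) (shiftIdx h j)) (Fin.last m) (Fin.last m)

end Algebra

end TwistedRTT

end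

open scoped PowerSeries Kronecker

noncomputable section

namespace TwistedRTT

/-! The heart of the matter is the case m = 1. Removing the indices 1 and 1' = 2n turns ℓ_{ij} into
ℓ_{ij} - ℓ_{i1} ℓ_{11}⁻¹ ℓ_{1j}, and it must be shown that these series satisfy the exchange
relations for the smaller R-matrix.

Two facts give this. On the algebraic side (`exchange_reduce`), suppose R preserves the weight given
by 1 for the first index, -1 for the last and 0 otherwise, acts on e_1 ⊗ e_k (k in the middle)
diagonally up to other weight-preserving terms, and has an invertible entry at (1,1'). Then R L₁ L'₂
= L'₂ L₁ R' can be multiplied on both sides by suitable vectors G and H that eliminate all outer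
indices. What remains is the exchange relation for the reduced L, L', with R and R' replaced by
their Schur complements with respect to the (1,1') entry. On the side of the R-matrix (`redR_embR`),
this Schur complement of R̄^{[r+1]} is exactly R̄^{[r]}: only the terms e_{i'j'} ⊗ e_{ij} change,
and ξ^{[r+1]} = q^{-2} ξ^{[r]} makes their coefficients match.

The relations are families of identities between coefficients of u^a v^b, whereas elimination needs
a ring containing all the series. For each of the sign pairs ++, --, +- a `SeriesModel` embeds them
in A⟦X⟧⟦X⟧ after a monomial change of variables.

The remaining relations involve only constant terms, which the reduction does not change, because
the constant terms of ℒ^± are triangular. The same triangularity makes the leading blocks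
invertible. Sylvester's identity `schur_schur` shows that a composite of reductions is a reduction;
together with uniqueness on generators this gives the compatibility, and by induction on m it gives
existence. -/

/-! ### Reduction of exchange relations by one pair of indices

The index set is `Option (Option V)`: `none` stands for the first index, `some none` for the
last one and `some (some v)` for the indices in between. -/

section Core

variable {V B : Type*} [Ring B]

/-- The weight of an index with respect to the first basis vector. -/
def wt : Option (Option V) → ℤ
  | none => 1
  | some none => -1
  | some (some _) => 0

/-- The quasideterminant `ℓ_{ij} - ℓ_{i1} ℓ_{11}⁻¹ ℓ_{1j}`, with `a'` in place of `ℓ_{11}⁻¹`. -/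
def redL (L : Option (Option V) → Option (Option V) → B) (a' : B) (i j : Option (Option V)) : B :=
  L i j - L i none * a' * L none j

/-- The Schur complement of a four-index array with respect to the pair (first, last). -/
def redR (R : Option (Option V) → Option (Option V) → Option (Option V) → Option (Option V) → B)
    (θ' : B) (i k j l : V) : B :=
  R (some (some i)) (some (some k)) (some (some j)) (some (some l)) -
    R (some (some i)) (some (some k)) none (some none) * θ' *
      R none (some none) (some (some j)) (some (some l))

/-- The conditions on a four-index array under which the exchange relations reduce. -/
structure Reducible [DecidableEq V]
    (R : Option (Option V) → Option (Option V) → Option (Option V) → Option (Option V) → B)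
    (α α' θ' : B) : Prop where
  weight : ∀ i k j l, wt i + wt k ≠ wt j + wt l → R i k j l = 0
  diag : ∀ k l : V, R none (some (some k)) none (some (some l)) = if k = l then α else 0
  mul_inv : α * α' = 1
  inv_mul : α' * α = 1
  corner_mul_inv : R none (some none) none (some none) * θ' = 1
  corner_inv_mul : θ' * R none (some none) none (some none) = 1

variable [Fintype V]

theorem sum_index (f : Option (Option V) → B) :
    ∑ t, f t = f none + (f (some none) + ∑ v : V, f (some (some v))) := by
  rw [Fintype.sum_option, Fintype.sum_option]

variable [DecidableEq V]

/-- G is a row vector of the form e_i ⊗ e_k plus multiples of e_i ⊗ e_1, e_1 ⊗ e_{1'}, e_1 ⊗ e_l and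
e_1 ⊗ e_1. It eliminates the first column of L' when it meets L' directly, and GR eliminates the
first column of L in every second index other than 1. The exceptional second index is left to the
right eliminator, which annihilates the first row of L'. -/
theorem exists_left_eliminator
    {R : Option (Option V) → Option (Option V) → Option (Option V) → Option (Option V) → B}
    {α α' θ' : B} (hR : Reducible R α α' θ')
    (L L' : Option (Option V) → Option (Option V) → B) {a b : B}
    (ha : a * L none none = 1) (hb : b * L' none none = 1) (i k : V) :
    ∃ G : Option (Option V) → Option (Option V) → B,
      (∀ r, G (some none) r = 0) ∧
      (∀ p, ∑ r, G p r * L' r none = 0) ∧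
      (∀ p r : V, ∑ s, G (some (some p)) s * L' s (some (some r)) =
        if p = i then redL L' b (some (some k)) (some (some r)) else 0) ∧
      (∀ l, ∑ t, (∑ p, ∑ r, G p r * R p r t (some l)) * L t none = 0) ∧
      (∀ j : V, ∑ t, (∑ p, ∑ r, G p r * R p r t (some none)) * L t (some (some j)) = 0) ∧
      (∀ j l : V, ∑ t, (∑ p, ∑ r, G p r * R p r t (some (some l))) * L t (some (some j)) =
        ∑ t, redR R θ' i k t l * redL L a (some (some t)) (some (some j))) := by
  -- The coefficients are solved for in turn: ν clears the first column of L' in row i; γ cancels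
  -- the (1,1') entry of GR and so produces `redR`; g gives GR the entries at (1,l) that clear the
  -- first column of L; κ clears the first column of L' in row 1. The choice of κ is free: by
  -- weight, row (1,1) of R meets only column (1,1), which no condition on GR involves.
  set ν : B := -(L' (some (some k)) none * b) with hν
  set γ : B := -(R (some (some i)) (some (some k)) none (some none) * θ') with hγ
  set g : V → B := fun l =>
    (-(∑ t, redR R θ' i k t l * L (some (some t)) none) * a
      - ν * R (some (some i)) none none (some (some l))) * α' with hg
  set κ : B := -((∑ l, g l * L' (some (some l)) none + γ * L' (some none) none) * b) with hκ
  let G : Option (Option V) → Option (Option V) → B := fun p r =>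
    match p, r with
    | none, none => κ
    | none, some none => γ
    | none, some (some l) => g l
    | some none, _ => 0
    | some (some p), none => if p = i then ν else 0
    | some (some _), some none => 0
    | some (some p), some (some r) => if p = i then (if r = k then 1 else 0) else 0
  have hw := hR.weight
  have e1 : ∑ p, ∑ r, G p r * R p r none (some none) = 0 := by
    have h1 : R none none none (some none) = 0 := hw _ _ _ _ (by simp [wt])
    have h2 : ∀ l : V, R none (some (some l)) none (some none) = 0 :=
      fun l => hw _ _ _ _ (by simp [wt])
    have h3 : ∀ l : V, R (some (some l)) none none (some none) = 0 :=
      fun l => hw _ _ _ _ (by simp [wt])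
    simp [Fintype.sum_option, G, h1, h2, h3, hγ, ite_mul,
      Finset.sum_add_distrib, mul_assoc, hR.corner_inv_mul]
  -- These column pairs have weight at most -1, while G is supported on row pairs of weight at least
  -- 0.
  have e2 : ∀ t, ∑ p, ∑ r, G p r * R p r (some t) (some none) = 0 := by
    intro t
    have ht : wt (some t) ≤ 0 := by cases t <;> simp [wt]
    have key : ∀ p r, (∃ x, p = none ∧ r = x) ∨ (∃ x, p = some (some x) ∧ r ≠ some none) →
        R p r (some t) (some none) = 0 := by
      rintro p r (⟨x, rfl, rfl⟩ | ⟨x, rfl, hr⟩)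
      · apply hw
        have : -1 ≤ wt r := by rcases r with _ | _ | _ <;> simp [wt]
        simp only [wt] at *
        omega
      · apply hw
        have : 0 ≤ wt r := by rcases r with _ | _ | _ <;> simp [wt] at *
        simp only [wt] at *
        omega
    refine Finset.sum_eq_zero fun p _ => Finset.sum_eq_zero fun r _ => ?_
    rcases p with _ | _ | p
    · rw [key _ _ (Or.inl ⟨_, rfl, rfl⟩), mul_zero]
    · simp [G]
    · by_cases hr : r = some none
      · subst hr; simp [G]
      · rw [key _ _ (Or.inr ⟨_, rfl, hr⟩), mul_zero]
  have e3 : ∀ l : V, ∑ p, ∑ r, G p r * R p r none (some (some l)) =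
      -(∑ t, redR R θ' i k t l * L (some (some t)) none) * a := by
    intro l
    have h1 : R none none none (some (some l)) = 0 := hw _ _ _ _ (by simp [wt])
    have h2 : R none (some none) none (some (some l)) = 0 := hw _ _ _ _ (by simp [wt])
    have h3 : ∀ x y : V, R (some (some x)) (some (some y)) none (some (some l)) = 0 :=
      fun x y => hw _ _ _ _ (by simp [wt])
    simp [Fintype.sum_option, G, h1, h2, h3, hR.diag, ite_mul, Finset.sum_add_distrib]
    simp [hg, mul_assoc, hR.inv_mul]
  have e4 : ∀ t l : V, ∑ p, ∑ r, G p r * R p r (some (some t)) (some (some l)) =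
      redR R θ' i k t l := by
    intro t l
    have h1 : R none none (some (some t)) (some (some l)) = 0 := hw _ _ _ _ (by simp [wt])
    have h2 : ∀ x, R none (some (some x)) (some (some t)) (some (some l)) = 0 :=
      fun x => hw _ _ _ _ (by simp [wt])
    have h3 : ∀ x : V, R (some (some x)) none (some (some t)) (some (some l)) = 0 :=
      fun x => hw _ _ _ _ (by simp [wt])
    simp [Fintype.sum_option, G, h1, h2, h3, ite_mul, Finset.sum_add_distrib, redR, hγ]
    abel
  have e5 : ∀ l : V, ∑ p, ∑ r, G p r * R p r (some none) (some (some l)) = 0 := by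
    intro l
    have h1 : ∀ r, R none r (some none) (some (some l)) = 0 :=
      fun r => hw _ _ _ _ (by rcases r with _ | _ | _ <;> simp [wt])
    have h2 : ∀ x, R (some (some x)) none (some none) (some (some l)) = 0 :=
      fun x => hw _ _ _ _ (by simp [wt])
    have h3 : ∀ x y : V, R (some (some x)) (some (some y)) (some none) (some (some l)) = 0 :=
      fun x y => hw _ _ _ _ (by simp [wt])
    simp [Fintype.sum_option, G, h1, h2, h3]
  refine ⟨G, fun r => rfl, ?_, ?_, ?_, ?_, ?_⟩
  · rintro (_ | _ | p)
    · simp [Fintype.sum_option, G, hκ, mul_assoc, hb]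
      abel
    · simp [G]
    · by_cases hp : p = i <;> simp [Fintype.sum_option, G, hp, hν, mul_assoc, hb, ite_mul]
  · intro p r
    by_cases hp : p = i <;>
      simp [Fintype.sum_option, G, hp, hν, redL, ite_mul, sub_eq_add_neg, add_comm]
  · rintro (_ | l)
    · refine (sum_index _).trans ?_
      simp only [e1, e2, zero_mul, Finset.sum_const_zero, add_zero]
    · refine (sum_index _).trans ?_
      simp only [e3, e4, e5, mul_assoc, ha, mul_one, zero_mul, zero_add, neg_add_cancel]
  · intro j
    refine (sum_index _).trans ?_
    simp only [e1, e2, zero_mul, Finset.sum_const_zero, add_zero]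
  · intro j l
    refine (sum_index _).trans ?_
    simp only [e3, e4, e5, redL, mul_sub, Finset.sum_sub_distrib, Finset.sum_mul, neg_mul,
      zero_mul, mul_assoc]
    abel

/-- This is the left eliminator for the transposed arrays over the opposite ring; the hypotheses on
R are stable under that symmetry. -/
theorem exists_right_eliminator
    {R : Option (Option V) → Option (Option V) → Option (Option V) → Option (Option V) → B}
    {α α' θ' : B} (hR : Reducible R α α' θ')
    (L L' : Option (Option V) → Option (Option V) → B) {a b : B}
    (ha : L none none * a = 1) (hb : L' none none * b = 1) (j l : V) :
    ∃ H : Option (Option V) → Option (Option V) → B,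
      (∀ r, H (some none) r = 0) ∧
      (∀ p, ∑ r, L' none r * H p r = 0) ∧
      (∀ p r : V, ∑ s, L' (some (some r)) s * H (some (some p)) s =
        if p = j then redL L' b (some (some r)) (some (some l)) else 0) ∧
      (∀ k, ∑ t, L none t * (∑ p, ∑ r, R t (some k) p r * H p r) = 0) ∧
      (∀ i : V, ∑ t, L (some (some i)) t * (∑ p, ∑ r, R t (some none) p r * H p r) = 0) ∧
      (∀ i k : V, ∑ t, L (some (some i)) t * (∑ p, ∑ r, R t (some (some k)) p r * H p r) =
        ∑ t, redL L a (some (some i)) (some (some t)) * redR R θ' t k j l) := by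
  have hR' : Reducible (B := Bᵐᵒᵖ) (fun i k j l => MulOpposite.op (R j l i k))
      (MulOpposite.op α) (MulOpposite.op α') (MulOpposite.op θ') :=
    { weight := fun i k j l h => by
        rw [hR.weight _ _ _ _ (Ne.symm h), MulOpposite.op_zero]
      diag := fun k l => by
        rw [hR.diag]
        by_cases h : k = l
        · simp [h]
        · simp [h, Ne.symm h]
      mul_inv := by rw [← MulOpposite.op_mul, hR.inv_mul, MulOpposite.op_one]
      inv_mul := by rw [← MulOpposite.op_mul, hR.mul_inv, MulOpposite.op_one]
      corner_mul_inv := by rw [← MulOpposite.op_mul, hR.corner_inv_mul, MulOpposite.op_one]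
      corner_inv_mul := by rw [← MulOpposite.op_mul, hR.corner_mul_inv, MulOpposite.op_one] }
  obtain ⟨G, h1, h2, h3, h4, h5, h6⟩ := exists_left_eliminator hR'
    (fun i j => MulOpposite.op (L j i)) (fun i j => MulOpposite.op (L' j i))
    (a := MulOpposite.op a) (b := MulOpposite.op b)
    (by rw [← MulOpposite.op_mul, ha, MulOpposite.op_one])
    (by rw [← MulOpposite.op_mul, hb, MulOpposite.op_one]) j l
  refine ⟨fun p r => (G p r).unop, fun r => by simp [h1], fun p => ?_, fun p r => ?_, fun k => ?_,
    fun i => ?_, fun i k => ?_⟩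
  · simpa using congrArg MulOpposite.unop (h2 p)
  · have := congrArg MulOpposite.unop (h3 p r)
    by_cases hp : p = j <;> simpa [redL, hp, mul_assoc] using this
  · simpa only [MulOpposite.unop_zero, Finset.unop_sum, MulOpposite.unop_mul,
      MulOpposite.unop_op] using congrArg MulOpposite.unop (h4 k)
  · simpa only [MulOpposite.unop_zero, Finset.unop_sum, MulOpposite.unop_mul,
      MulOpposite.unop_op] using congrArg MulOpposite.unop (h5 i)
  · have := congrArg MulOpposite.unop (h6 i k)
    simp only [Finset.unop_sum, MulOpposite.unop_mul, MulOpposite.unop_op, redL, redR,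
      MulOpposite.unop_sub] at this
    simpa only [redL, redR, mul_assoc] using this

/-- Exchange relations `R L₁ L'₂ = L'₂ L₁ R'` pass to the quasideterminants of the middle block
and to the Schur complements of `R` and `R'`. -/
theorem exchange_reduce
    {R R' : Option (Option V) → Option (Option V) → Option (Option V) → Option (Option V) → B}
    {α α' θ' ρ ρ' η' : B} (hR : Reducible R α α' θ') (hR' : Reducible R' ρ ρ' η')
    (L L' : Option (Option V) → Option (Option V) → B) {a b : B}
    (ha : a * L none none = 1) (ha' : L none none * a = 1)
    (hb : b * L' none none = 1) (hb' : L' none none * b = 1)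
    (hrel : ∀ i k j l, ∑ p, ∑ r, R i k p r * (L p j * L' r l) =
      ∑ p, ∑ r, (L' k r * L i p) * R' p r j l) (i k j l : V) :
    ∑ p, ∑ r, redR R θ' i k p r *
        (redL L a (some (some p)) (some (some j)) * redL L' b (some (some r)) (some (some l))) =
      ∑ p, ∑ r, (redL L' b (some (some k)) (some (some r)) *
        redL L a (some (some i)) (some (some p))) * redR R' η' p r j l := by
  obtain ⟨G, hG1, hG2, hG3, hG4, hG5, hG6⟩ := exists_left_eliminator hR L L' ha hb i k
  obtain ⟨H, hH1, hH2, hH3, hH4, hH5, hH6⟩ := exists_right_eliminator hR' L L' ha' hb' j l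
  let J := Option (Option V)
  -- The exchange relation is contracted with G on the left and H on the right. Regrouping puts GR
  -- next to L and L' next to H on one side, GL' and L next to R'H on the other, so every outer
  -- index meets a vanishing factor.
  have key : ∑ x, ∑ y, ∑ z, ∑ w,
      G x y * (∑ p, ∑ r, R x y p r * (L p z * L' r w)) * H z w =
      ∑ x, ∑ y, ∑ z, ∑ w, G x y * (∑ p, ∑ r, (L' y r * L x p) * R' p r z w) * H z w := by
    simp only [hrel]
  have hl : ∑ x, ∑ y, ∑ z, ∑ w,
      G x y * (∑ p, ∑ r, R x y p r * (L p z * L' r w)) * H z w =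
      ∑ z, ∑ r, (∑ t, (∑ p, ∑ s, G p s * R p s t r) * L t z) * ∑ w, L' r w * H z w := by
    simp only [Finset.sum_mul, Finset.mul_sum, mul_assoc]
    let e : J × J × J × J × J × J ≃ J × J × J × J × J × J :=
      ⟨fun (x, y, z, w, p, r) => (z, r, w, p, x, y), fun (z, r, w, p, x, y) => (x, y, z, w, p, r),
        fun _ => rfl, fun _ => rfl⟩
    have := Fintype.sum_equiv e
      (fun (x, y, z, w, p, r) => G x y * (R x y p r * (L p z * (L' r w * H z w))))
      (fun (z, r, w, p, x, y) => G x y * (R x y p r * (L p z * (L' r w * H z w)))) fun _ => rfl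
    simp only [Fintype.sum_prod_type] at this
    exact this
  have hr : ∑ x, ∑ y, ∑ z, ∑ w,
      G x y * (∑ p, ∑ r, (L' y r * L x p) * R' p r z w) * H z w =
      ∑ x, ∑ r, (∑ y, G x y * L' y r) * ∑ t, L x t * (∑ p, ∑ s, R' t r p s * H p s) := by
    simp only [Finset.sum_mul, Finset.mul_sum, mul_assoc]
    let e : J × J × J × J × J × J ≃ J × J × J × J × J × J :=
      ⟨fun (x, y, z, w, p, r) => (x, r, p, z, w, y), fun (x, r, p, z, w, y) => (x, y, z, w, p, r),
        fun _ => rfl, fun _ => rfl⟩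
    have := Fintype.sum_equiv e
      (fun (x, y, z, w, p, r) => G x y * (L' y r * (L x p * (R' p r z w * H z w))))
      (fun (x, r, p, z, w, y) => G x y * (L' y r * (L x p * (R' p r z w * H z w)))) fun _ => rfl
    simp only [Fintype.sum_prod_type] at this
    exact this
  have fst1 : ∑ r, (∑ t, (∑ p, ∑ s, G p s * R p s t r) * L t none) * ∑ w, L' r w * H none w = 0 := by
    refine (Fintype.sum_option _).trans ?_
    simp only [hH2, hG4, mul_zero, zero_mul, Finset.sum_const_zero, zero_add]
  have fst2 : ∑ r, (∑ y, G none y * L' y r) *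
      ∑ t, L none t * (∑ p, ∑ s, R' t r p s * H p s) = 0 := by
    refine (Fintype.sum_option _).trans ?_
    simp only [hG2, hH4, mul_zero, zero_mul, Finset.sum_const_zero, zero_add]
  have fin1 : ∀ z : V, ∑ r, (∑ t, (∑ p, ∑ s, G p s * R p s t r) * L t (some (some z))) *
      ∑ w, L' r w * H (some (some z)) w =
      if z = j then ∑ r, (∑ t, redR R θ' i k t r * redL L a (some (some t)) (some (some z))) *
        redL L' b (some (some r)) (some (some l)) else 0 := by
    intro z
    refine (sum_index _).trans ?_
    simp only [hH2, hG5, hG6, hH3, mul_zero, zero_mul, zero_add, mul_ite]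
    split_ifs <;> simp
  have fin2 : ∀ z : V, ∑ r, (∑ y, G (some (some z)) y * L' y r) *
      ∑ t, L (some (some z)) t * (∑ p, ∑ s, R' t r p s * H p s) =
      if z = i then ∑ r, redL L' b (some (some k)) (some (some r)) *
        (∑ t, redL L a (some (some z)) (some (some t)) * redR R' η' t r j l) else 0 := by
    intro z
    refine (sum_index _).trans ?_
    simp only [hG2, hH5, hH6, hG3, mul_zero, zero_mul, zero_add, ite_mul]
    split_ifs <;> simp
  have key' := ((sum_index _).symm.trans (hl.symm.trans (key.trans hr))).trans (sum_index _)
  simp only [fst1, fst2, fin1, fin2, hH1, hG1, mul_zero, zero_mul, Finset.sum_const_zero, zero_add,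
    Finset.sum_ite_eq', Finset.mem_univ, if_true] at key'
  simp only [Finset.sum_mul, Finset.mul_sum, ← mul_assoc] at key' ⊢
  rw [Finset.sum_comm, key', Finset.sum_comm]

end Core

/-! ### The entries of the R-matrix and its Schur complement -/

section Entries

variable {K : Type*} [Field K]

theorem mu_kronecker_apply (n : ℕ) (a b c d i k j l : Fin (2 * n)) :
    (mu K n a b ⊗ₖ mu K n c d) (i, k) (j, l) =
      if a = i ∧ b = j ∧ c = k ∧ d = l then 1 else 0 := by
  simp only [mu, Matrix.kroneckerMap_apply, Matrix.single_apply, mul_ite, mul_one, mul_zero]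
  grind

theorem Rbar_apply (q : K) (n : ℕ) (i k j l : Fin (2 * n)) :
    Rbar q n (i, k) (j, l) =
      (if i = k ∧ i = j ∧ i = l then 1 else 0)
      + ((PowerSeries.X - 1) * (PowerSeries.C q * PowerSeries.X - PowerSeries.C q⁻¹)⁻¹) *
        (if j = i ∧ l = k ∧ i ≠ k ∧ i ≠ k.rev then 1 else 0)
      + (PowerSeries.C (q - q⁻¹) * (PowerSeries.C q * PowerSeries.X - PowerSeries.C q⁻¹)⁻¹) *
        (if j = k ∧ l = i ∧ k < i ∧ i ≠ k.rev then 1 else 0)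
      + (PowerSeries.C (q - q⁻¹) * PowerSeries.X *
          (PowerSeries.C q * PowerSeries.X - PowerSeries.C q⁻¹)⁻¹) *
        (if j = k ∧ l = i ∧ i < k ∧ i ≠ k.rev then 1 else 0)
      + ((PowerSeries.X - PowerSeries.C (q ^ (-2 : ℤ))) *
          (PowerSeries.X - PowerSeries.C (xi q n)))⁻¹ *
        (if i = k.rev ∧ j = l.rev then aCoeff q n k l else 0) := by
  have h1 : (∑ a, mu K n a a ⊗ₖ mu K n a a) (i, k) (j, l) =
      if i = k ∧ i = j ∧ i = l then 1 else 0 := by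
    simp only [Matrix.sum_apply, mu_kronecker_apply]
    rw [Finset.sum_eq_single i (fun b _ hb => by simp [hb]) (by simp)]
    grind
  have aux : ∀ (P : Fin (2 * n) → Fin (2 * n) → Prop) [∀ a b, Decidable (P a b)],
      (∑ a, ∑ b, if P a b then mu K n a a ⊗ₖ mu K n b b else 0) (i, k) (j, l) =
      if j = i ∧ l = k ∧ P i k then 1 else 0 := by
    intro P _
    simp only [Matrix.sum_apply, apply_ite (fun M : Matrix _ _ K⟦X⟧ => M (i, k) (j, l)),
      mu_kronecker_apply, Matrix.zero_apply]
    rw [Finset.sum_eq_single i (fun b _ hb => by simp [hb]) (by simp),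
      Finset.sum_eq_single k (fun b _ hb => by simp [hb]) (by simp)]
    grind
  have aux' : ∀ (P : Fin (2 * n) → Fin (2 * n) → Prop) [∀ a b, Decidable (P a b)],
      (∑ a, ∑ b, if P a b then mu K n a b ⊗ₖ mu K n b a else 0) (i, k) (j, l) =
      if j = k ∧ l = i ∧ P i k then 1 else 0 := by
    intro P _
    simp only [Matrix.sum_apply, apply_ite (fun M : Matrix _ _ K⟦X⟧ => M (i, k) (j, l)),
      mu_kronecker_apply, Matrix.zero_apply]
    rw [Finset.sum_eq_single i (fun b _ hb => by simp [hb]) (by simp),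
      Finset.sum_eq_single k (fun b _ hb => by simp [hb]) (by simp)]
    grind
  have h5 : (∑ a, ∑ b, aCoeff q n a b • (mu K n a.rev b.rev ⊗ₖ mu K n a b)) (i, k) (j, l) =
      if i = k.rev ∧ j = l.rev then aCoeff q n k l else 0 := by
    simp only [Matrix.sum_apply, Matrix.smul_apply, mu_kronecker_apply, smul_eq_mul]
    rw [Finset.sum_eq_single k (fun b _ hb => by simp [hb]) (by simp),
      Finset.sum_eq_single l (fun b _ hb => by simp [hb]) (by simp)]
    grind
  simp only [Rbar, Matrix.add_apply, Matrix.smul_apply, smul_eq_mul]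
  rw [h1, aux (fun i j => i ≠ j ∧ i ≠ j.rev), aux' (fun i j => j < i ∧ i ≠ j.rev),
    aux' (fun i j => i < j ∧ i ≠ j.rev), h5]

/-- The labelling of the indices by the first one, the last one, and those in between. -/
def emb {r n : ℕ} (h : r + 1 = n) : Option (Option (Fin (2 * r))) → Fin (2 * n)
  | none => firstIdx h 0
  | some none => (firstIdx h 0).rev
  | some (some v) => shiftIdx h v

theorem emb_bijective {r n : ℕ} (h : r + 1 = n) : Function.Bijective (emb h) := by
  constructor
  · rintro (_ | _ | x) (_ | _ | y) hxy <;>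
      simp only [emb, firstIdx, shiftIdx, Fin.ext_iff, Fin.val_rev] at hxy <;> simp <;> grind
  · intro y
    by_cases h1 : (y : ℕ) = 0
    · exact ⟨none, Fin.ext (by simp [emb, firstIdx, h1])⟩
    · by_cases h2 : (y : ℕ) = 2 * n - 1
      · exact ⟨some none, Fin.ext (by simp [emb, firstIdx, Fin.val_rev, h2])⟩
      · exact ⟨some (some ⟨y - 1, by omega⟩), Fin.ext (by simp [emb, shiftIdx]; omega)⟩

theorem sum_emb {M : Type*} [AddCommMonoid M] {r n : ℕ} (h : r + 1 = n) (f : Fin (2 * n) → M) :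
    ∑ i, f i = ∑ i, f (emb h i) :=
  (Fintype.sum_bijective _ (emb_bijective h) _ _ fun _ => rfl).symm

theorem shiftIdx_injective {r m n : ℕ} (h : r + m = n) :
    Function.Injective (shiftIdx (m := m) h) := fun a b hab => by
  simpa [shiftIdx, Fin.ext_iff] using hab

theorem rev_shiftIdx {r m n : ℕ} (h : r + m = n) (i : Fin (2 * r)) :
    (shiftIdx h i).rev = shiftIdx h i.rev := by
  ext
  simp only [shiftIdx, Fin.val_rev]
  omega

theorem wt_rev {r n : ℕ} (h : r + 1 = n) (i j : Option (Option (Fin (2 * r))))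
    (hij : emb h i = (emb h j).rev) : wt i = -wt j := by
  rcases i with _ | _ | x <;> rcases j with _ | _ | y <;>
    simp [emb, firstIdx, shiftIdx, Fin.ext_iff, Fin.val_rev, wt] at * <;> omega

theorem xi_eq {q : K} (hq : q ≠ 0) {r n : ℕ} (h : r + 1 = n) :
    xi q n = q ^ (-2 : ℤ) * xi q r := by
  subst h
  rw [xi, xi, mul_neg, ← zpow_add₀ hq]
  congr 2
  push_cast
  ring

theorem bar_shiftIdx {r n : ℕ} (h : r + 1 = n) (i : Fin (2 * r)) :
    bar n (shiftIdx h i) = bar r i := by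
  subst h
  have hv : (shiftIdx (m := 1) rfl i : ℕ) = 1 + i := rfl
  by_cases hi : (i : ℕ) < r
  · rw [bar, bar, if_pos (by omega), if_pos hi, hv]
    push_cast
    ring
  · rw [bar, bar, if_neg (by omega), if_neg hi, hv]
    push_cast
    ring

/-- The coefficient of `e_{ii} ⊗ e_{jj}`, `j ≠ i, i'`, in `R̄(u)`. -/
def diagCoeff (q : K) : K⟦X⟧ :=
  (PowerSeries.X - 1) * (PowerSeries.C q * PowerSeries.X - PowerSeries.C q⁻¹)⁻¹

/-- The common denominator of the coefficients of `e_{i'j'} ⊗ e_{ij}` in `R̄(u)`. -/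
def denom (q : K) (n : ℕ) : K⟦X⟧ :=
  (PowerSeries.X - PowerSeries.C (q ^ (-2 : ℤ))) * (PowerSeries.X - PowerSeries.C (xi q n))

theorem xi_ne_zero {q : K} (hq : q ≠ 0) (n : ℕ) : xi q n ≠ 0 :=
  neg_ne_zero.mpr (zpow_ne_zero _ hq)

theorem constantCoeff_denom_ne_zero {q : K} (hq : q ≠ 0) (n : ℕ) :
    PowerSeries.constantCoeff (denom q n) ≠ 0 := by
  simp [denom, xi_ne_zero hq, hq]

theorem constantCoeff_diagCoeff_ne_zero {q : K} (hq : q ≠ 0) :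
    PowerSeries.constantCoeff (diagCoeff q) ≠ 0 := by
  simp [diagCoeff, hq]

theorem aCoeff_self (q : K) (n : ℕ) (i : Fin (2 * n)) :
    aCoeff q n i i = (PowerSeries.C (q ^ (-2 : ℤ)) * PowerSeries.X - PowerSeries.C (xi q n)) *
      (PowerSeries.X - 1) := by
  simp [aCoeff]

theorem aCoeff_of_lt (q : K) (n : ℕ) {i j : Fin (2 * n)} (hij : i < j) :
    aCoeff q n i j = PowerSeries.C (q ^ (-2 : ℤ) - 1) *
      (PowerSeries.C (q ^ (bar n i - bar n j)) * PowerSeries.C (xi q n) * (PowerSeries.X - 1) -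
        (if i = j.rev then 1 else 0) * (PowerSeries.X - PowerSeries.C (xi q n))) := by
  simp only [aCoeff, if_neg hij.ne, if_pos hij]

theorem aCoeff_of_gt (q : K) (n : ℕ) {i j : Fin (2 * n)} (hij : j < i) :
    aCoeff q n i j = PowerSeries.C (q ^ (-2 : ℤ) - 1) * PowerSeries.X *
      (PowerSeries.C (q ^ (bar n i - bar n j)) * (PowerSeries.X - 1) -
        (if i = j.rev then 1 else 0) * (PowerSeries.X - PowerSeries.C (xi q n))) := by
  simp only [aCoeff, if_neg hij.ne', if_neg hij.not_gt]

/-- The denominator-free form of the Schur complement identity for the coefficients of e_{i'j'} ⊗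
e_{ij}. The bar of the removed index cancels in the product of the two off-diagonal entries, and
after substituting ξ^{[n]} = q^{-2} ξ^{[r]} a polynomial identity remains. -/
theorem aCoeff_schur {q : K} (hq : q ≠ 0) {r n : ℕ} (h : r + 1 = n) (k l : Fin (2 * r)) :
    aCoeff q n (shiftIdx h k) (shiftIdx h l) * aCoeff q n (firstIdx h 0).rev (firstIdx h 0).rev *
        denom q r -
      aCoeff q n (shiftIdx h k) (firstIdx h 0).rev * aCoeff q n (firstIdx h 0).rev (shiftIdx h l) *
        denom q r =
    aCoeff q r k l * denom q n * aCoeff q n (firstIdx h 0).rev (firstIdx h 0).rev := by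
  have lt : ∀ k : Fin (2 * r), shiftIdx h k < (firstIdx h 0).rev := fun k => by
    simp only [shiftIdx, firstIdx, Fin.lt_def, Fin.val_rev]
    have := k.isLt
    omega
  have ne : ∀ k : Fin (2 * r), shiftIdx h k ≠ firstIdx h 0 := fun k => by
    simp only [shiftIdx, firstIdx, Ne, Fin.ext_iff]
    simp
  have ne' : ∀ k : Fin (2 * r), (firstIdx h 0).rev ≠ (shiftIdx h k).rev := fun k hk =>
    ne k (Fin.rev_injective hk).symm
  have hC : ∀ x y : K, PowerSeries.C (x * y) = PowerSeries.C x * PowerSeries.C y :=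
    fun x y => map_mul _ x y
  have hz : ∀ x y z : ℤ, (PowerSeries.C (q ^ (x - z)) : K⟦X⟧) =
      PowerSeries.C (q ^ (x - y)) * PowerSeries.C (q ^ (y - z)) := fun x y z => by
    rw [← hC, ← zpow_add₀ hq]; congr 2; ring
  have hrev : shiftIdx h k = (shiftIdx h l).rev ↔ k = l.rev := by
    rw [rev_shiftIdx]; exact (shiftIdx_injective h).eq_iff
  have shift_lt : ∀ {k l : Fin (2 * r)}, k < l → shiftIdx h k < shiftIdx h l := fun {k l} hkl => by
    simp only [Fin.lt_def] at hkl ⊢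
    exact Nat.add_lt_add_left hkl 1
  rw [aCoeff_self, aCoeff_of_lt _ _ (lt k), aCoeff_of_gt _ _ (lt l), Fin.rev_rev, if_neg (ne k),
    if_neg (ne' l), denom, denom, xi_eq hq h]
  rcases lt_trichotomy k l with hkl | rfl | hkl
  · rw [aCoeff_of_lt _ _ (shift_lt hkl), aCoeff_of_lt _ _ hkl, xi_eq hq h]
    simp only [bar_shiftIdx, hrev]
    rw [hz (bar r k) (bar n (firstIdx h 0).rev) (bar r l)]
    simp only [hC, map_sub, map_one]
    generalize (if k = l.rev then (1 : K⟦X⟧) else 0) = δ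
    ring
  -- On the diagonal the two powers of q from the off-diagonal entries are mutually inverse.
  · have h1 := hz (bar r k) (bar n (firstIdx h 0).rev) (bar r k)
    rw [sub_self, zpow_zero, map_one] at h1
    rw [aCoeff_self, aCoeff_self, xi_eq hq h]
    simp only [bar_shiftIdx]
    simp only [hC, map_sub, map_one, zero_mul, sub_zero]
    linear_combination (PowerSeries.C (q ^ (-2 : ℤ)) - 1) ^ 2 * PowerSeries.C (q ^ (-2 : ℤ)) *
      PowerSeries.C (xi q r) * PowerSeries.X * (PowerSeries.X - 1) ^ 2 *
      ((PowerSeries.X - PowerSeries.C (q ^ (-2 : ℤ))) * (PowerSeries.X - PowerSeries.C (xi q r)))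
      * h1
  · rw [aCoeff_of_gt _ _ (shift_lt hkl), aCoeff_of_gt _ _ hkl, xi_eq hq h]
    simp only [bar_shiftIdx, hrev]
    rw [hz (bar r k) (bar n (firstIdx h 0).rev) (bar r l)]
    simp only [hC, map_sub, map_one]
    generalize (if k = l.rev then (1 : K⟦X⟧) else 0) = δ
    ring

/-- The array of entries of `R̄(u)`, indexed by `Option (Option (Fin (2 r)))`. -/
def embR (q : K) {r n : ℕ} (h : r + 1 = n) (i k j l : Option (Option (Fin (2 * r)))) : K⟦X⟧ :=
  Rbar q n (emb h i, emb h k) (emb h j, emb h l)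

/-- The terms of R̄ either keep or swap the two indices, or take a pair (j',j) to a pair (i',i); in
the last case both weights are 0, since i and i' have opposite weights. -/
theorem embR_weight (q : K) {r n : ℕ} (h : r + 1 = n) (i k j l : Option (Option (Fin (2 * r))))
    (hw : wt i + wt k ≠ wt j + wt l) : embR q h i k j l = 0 := by
  have inj := (emb_bijective h).injective
  have h1 : ¬(emb h i = emb h k ∧ emb h i = emb h j ∧ emb h i = emb h l) := by
    rintro ⟨e1, e2, e3⟩
    rw [← inj e1, ← inj e2, ← inj e3] at hw
    exact hw rfl
  have h2 : ¬(emb h j = emb h i ∧ emb h l = emb h k) := by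
    rintro ⟨e1, e2⟩
    rw [inj e1, inj e2] at hw
    exact hw rfl
  have h3 : ¬(emb h j = emb h k ∧ emb h l = emb h i) := by
    rintro ⟨e1, e2⟩
    rw [inj e1, inj e2] at hw
    exact hw (add_comm _ _)
  have h5 : ¬(emb h i = (emb h k).rev ∧ emb h j = (emb h l).rev) := by
    rintro ⟨e1, e2⟩
    have := wt_rev h _ _ e1
    have := wt_rev h _ _ e2
    omega
  rw [embR, Rbar_apply, if_neg h1, if_neg (by tauto), if_neg (by tauto), if_neg (by tauto),
    if_neg h5]
  simp

theorem embR_diag (q : K) {r n : ℕ} (h : r + 1 = n) (k l : Fin (2 * r)) :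
    embR q h none (some (some k)) none (some (some l)) = if k = l then diagCoeff q else 0 := by
  have inj := shiftIdx_injective h
  have h0 : ∀ x, firstIdx h 0 ≠ shiftIdx h x := fun x => by
    simp only [firstIdx, shiftIdx, Ne, Fin.ext_iff]
    simp only [Fin.val_zero]
    omega
  have h1 : ∀ x, firstIdx h 0 ≠ (shiftIdx h x).rev := fun x => by
    rw [rev_shiftIdx]; exact h0 _
  simp only [embR, emb, Rbar_apply]
  by_cases hkl : k = l
  · subst hkl
    simp [h0, h1, diagCoeff]
  · have : shiftIdx h l ≠ shiftIdx h k := fun e => hkl (inj e).symm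
    simp [h0, h1, this, hkl]

theorem ne_rev {n : ℕ} (i : Fin (2 * n)) : i ≠ i.rev := by
  rw [Ne, Fin.ext_iff, Fin.val_rev]
  omega

theorem Rbar_rev_rev (q : K) (n : ℕ) (k l : Fin (2 * n)) :
    Rbar q n (k.rev, k) (l.rev, l) = (denom q n)⁻¹ * aCoeff q n k l := by
  simp [Rbar_apply, denom, (ne_rev k).symm]

/-- The inverse of the coefficient of `e_{11} ⊗ e_{1'1'}` in `R̄(u)`. -/
def cornerInv (q : K) {r n : ℕ} (h : r + 1 = n) : K⟦X⟧ :=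
  denom q n * (aCoeff q n (firstIdx h 0).rev (firstIdx h 0).rev)⁻¹

theorem aCoeff_self_mul_inv {q : K} (hq : q ≠ 0) (n : ℕ) (i : Fin (2 * n)) :
    aCoeff q n i i * (aCoeff q n i i)⁻¹ = 1 :=
  PowerSeries.mul_inv_cancel _ (by simp [aCoeff_self, xi_ne_zero hq])

theorem denom_mul_inv {q : K} (hq : q ≠ 0) (n : ℕ) : denom q n * (denom q n)⁻¹ = 1 :=
  PowerSeries.mul_inv_cancel _ (constantCoeff_denom_ne_zero hq n)

theorem embR_corner (q : K) {r n : ℕ} (h : r + 1 = n) :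
    embR q h none (some none) none (some none) =
      (denom q n)⁻¹ * aCoeff q n (firstIdx h 0).rev (firstIdx h 0).rev := by
  rw [embR, ← Rbar_rev_rev]
  simp only [emb, Fin.rev_rev]

theorem embR_corner_mul {q : K} (hq : q ≠ 0) {r n : ℕ} (h : r + 1 = n) :
    embR q h none (some none) none (some none) * cornerInv q h = 1 := by
  rw [embR_corner, cornerInv]
  have h1 := aCoeff_self_mul_inv hq n (firstIdx h 0).rev
  have h2 := denom_mul_inv hq n
  linear_combination (denom q n * (denom q n)⁻¹) * h1 + h2

/-- The correction in the Schur complement lives only on positions with i = k' and j = l', so the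
first four kinds of terms are inherited unchanged and the last kind is governed by `aCoeff_schur`.
-/
theorem redR_embR {q : K} (hq : q ≠ 0) {r n : ℕ} (h : r + 1 = n) (i k j l : Fin (2 * r)) :
    redR (embR q h) (cornerInv q h) i k j l = Rbar q r (i, k) (j, l) := by
  have inj := shiftIdx_injective (m := 1) h
  have ne : ∀ k : Fin (2 * r), shiftIdx h k ≠ firstIdx h 0 := fun k => by
    simp only [shiftIdx, firstIdx, Ne, Fin.ext_iff, Fin.val_zero]
    omega
  have ne' : ∀ k : Fin (2 * r), shiftIdx h k ≠ (firstIdx h 0).rev := fun k hk =>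
    ne k.rev (by rw [← rev_shiftIdx, hk, Fin.rev_rev])
  have hlt : ∀ x y : Fin (2 * r), shiftIdx h x < shiftIdx h y ↔ x < y := fun x y => by
    simp only [Fin.lt_def, shiftIdx]
    exact Nat.add_lt_add_iff_left
  have hrev : ∀ x y : Fin (2 * r), shiftIdx h x = (shiftIdx h y).rev ↔ x = y.rev := fun x y => by
    rw [rev_shiftIdx]; exact inj.eq_iff
  have e1 : embR q h (some (some i)) (some (some k)) none (some none) =
      if i = k.rev then (denom q n)⁻¹ * aCoeff q n (shiftIdx h k) (firstIdx h 0).rev else 0 := by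
    split_ifs with hik
    · rw [← Rbar_rev_rev]
      simp only [embR, emb, Fin.rev_rev, hik, rev_shiftIdx]
    · simp only [embR, emb, Rbar_apply, hrev, hik, ne, (ne _).symm]
      simp
  have e2 : embR q h none (some none) (some (some j)) (some (some l)) =
      if j = l.rev then (denom q n)⁻¹ * aCoeff q n (firstIdx h 0).rev (shiftIdx h l) else 0 := by
    split_ifs with hjl
    · rw [← Rbar_rev_rev]
      simp only [embR, emb, Fin.rev_rev, hjl, rev_shiftIdx]
    · simp only [embR, emb, Rbar_apply, hrev, hjl, ne, ne', (ne _).symm]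
      simp
  have e3 : (if i = k.rev ∧ j = l.rev then
        (denom q n)⁻¹ * aCoeff q n (shiftIdx h k) (shiftIdx h l) else 0) -
      (if i = k.rev then (denom q n)⁻¹ * aCoeff q n (shiftIdx h k) (firstIdx h 0).rev else 0) *
        cornerInv q h *
      (if j = l.rev then (denom q n)⁻¹ * aCoeff q n (firstIdx h 0).rev (shiftIdx h l) else 0) =
      if i = k.rev ∧ j = l.rev then (denom q r)⁻¹ * aCoeff q r k l else 0 := by
    by_cases hik : i = k.rev
    · by_cases hjl : j = l.rev
      · rw [if_pos ⟨hik, hjl⟩, if_pos hik, if_pos hjl, if_pos ⟨hik, hjl⟩, cornerInv]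
        have h1 := aCoeff_self_mul_inv hq n (firstIdx h 0).rev
        have h2 := denom_mul_inv hq n
        have h3 := denom_mul_inv hq r
        have h4 := aCoeff_schur hq h k l
        generalize aCoeff q n (firstIdx h 0).rev (firstIdx h 0).rev = N at *
        generalize denom q n = D at *
        generalize denom q r = D' at *
        generalize D⁻¹ = x at *
        generalize D'⁻¹ = z at *
        generalize N⁻¹ = y at *
        generalize aCoeff q n (shiftIdx h k) (firstIdx h 0).rev = b at *
        generalize aCoeff q n (firstIdx h 0).rev (shiftIdx h l) = c at *
        generalize aCoeff q n (shiftIdx h k) (shiftIdx h l) = a at *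
        generalize aCoeff q r k l = a' at *
        -- Here x, y, z stand for the inverses of D, N, D'. The main term is `h4` divided by D N D';
        -- the others only cancel inverses.
        linear_combination (x * y * z) * h4 + (a' * z * D * x - x * a * z * D') * h1 +
          (a' * z - x * y * b * c) * h2 + (x * y * b * c - x * a) * h3
      · simp [hjl]
    · simp [hik]
  rw [redR, e1, e2, embR, Rbar_apply q r]
  simp only [emb, Rbar_apply, inj.eq_iff, hlt, hrev, ne_eq]
  rw [add_sub_assoc]
  congr 1
  simp only [denom, mul_ite, mul_zero] at e3 ⊢
  exact e3

theorem reducible_embR {q : K} (hq : q ≠ 0) {r n : ℕ} (h : r + 1 = n) {B : Type*} [Ring B]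
    (ρ : K⟦X⟧ →+* B) :
    Reducible (fun i k j l => ρ (embR q h i k j l)) (ρ (diagCoeff q)) (ρ (diagCoeff q)⁻¹)
      (ρ (cornerInv q h)) where
  weight i k j l hw := by rw [embR_weight q h i k j l hw, map_zero]
  diag k l := by rw [embR_diag]; split_ifs <;> simp
  mul_inv := by
    rw [← map_mul, PowerSeries.mul_inv_cancel _ (constantCoeff_diagCoeff_ne_zero hq), map_one]
  inv_mul := by
    rw [← map_mul, PowerSeries.inv_mul_cancel _ (constantCoeff_diagCoeff_ne_zero hq), map_one]
  corner_mul_inv := by rw [← map_mul, embR_corner_mul hq, map_one]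
  corner_inv_mul := by rw [← map_mul, mul_comm, embR_corner_mul hq, map_one]

/-- Exchange relations for `R̄^{[r + 1]}` reduce to exchange relations for `R̄^{[r]}` between the
quasideterminants `ℓ_{ij} - ℓ_{i1} ℓ_{11}⁻¹ ℓ_{1j}`. -/
theorem exchange_Rbar {q : K} (hq : q ≠ 0) {r n : ℕ} (h : r + 1 = n) {B : Type*} [Ring B]
    (ρ ρ' : K⟦X⟧ →+* B) (L L' : Fin (2 * n) → Fin (2 * n) → B) {a b : B}
    (ha : a * L (firstIdx h 0) (firstIdx h 0) = 1) (ha' : L (firstIdx h 0) (firstIdx h 0) * a = 1)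
    (hb : b * L' (firstIdx h 0) (firstIdx h 0) = 1)
    (hb' : L' (firstIdx h 0) (firstIdx h 0) * b = 1)
    (hrel : ∀ i k j l, ∑ p, ∑ r, ρ (Rbar q n (i, k) (p, r)) * (L p j * L' r l) =
      ∑ p, ∑ r, (L' k r * L i p) * ρ' (Rbar q n (p, r) (j, l)))
    (S S' : Fin (2 * r) → Fin (2 * r) → B)
    (hS : ∀ i j, S i j = L (shiftIdx h i) (shiftIdx h j) -
      L (shiftIdx h i) (firstIdx h 0) * a * L (firstIdx h 0) (shiftIdx h j))
    (hS' : ∀ i j, S' i j = L' (shiftIdx h i) (shiftIdx h j) -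
      L' (shiftIdx h i) (firstIdx h 0) * b * L' (firstIdx h 0) (shiftIdx h j))
    (i k j l : Fin (2 * r)) :
    ∑ p, ∑ s, ρ (Rbar q r (i, k) (p, s)) * (S p j * S' s l) =
      ∑ p, ∑ s, (S' k s * S i p) * ρ' (Rbar q r (p, s) (j, l)) := by
  have key := exchange_reduce (reducible_embR hq h ρ) (reducible_embR hq h ρ')
    (fun i j => L (emb h i) (emb h j)) (fun i j => L' (emb h i) (emb h j)) ha ha' hb hb'
    (fun i k j l => by
      have := hrel (emb h i) (emb h k) (emb h j) (emb h l)
      simpa only [sum_emb h, embR] using this) i k j l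
  have hred : ∀ (τ : K⟦X⟧ →+* B) (i k j l : Fin (2 * r)),
      redR (fun i k j l => τ (embR q h i k j l)) (τ (cornerInv q h)) i k j l =
      τ (Rbar q r (i, k) (j, l)) := fun τ i k j l => by
    rw [← redR_embR hq h, redR, redR, map_sub, map_mul, map_mul]
  simpa only [hred, hS, hS', redL, emb] using key

end Entries

/-! ### Formal series in two variables

The series in `u` and `v` that occur in the relations are power series in two suitable monomials;
they are regarded as elements of `A⟦X⟧⟦X⟧`. -/

section Series

/-- The homomorphism `∑ a_k X^k ↦ ∑ f(a_k) (c X)^k`. -/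
def twist {A B : Type*} [Ring A] [Ring B] (f : A →+* B) (c : B) (hc : ∀ a, Commute (f a) c) :
    A⟦X⟧ →+* B⟦X⟧ where
  toFun F := PowerSeries.mk fun k => f (PowerSeries.coeff k F) * c ^ k
  map_one' := by
    ext k
    rw [PowerSeries.coeff_mk, PowerSeries.coeff_one, PowerSeries.coeff_one]
    split_ifs with h <;> simp [h]
  map_zero' := by ext k; simp
  map_add' F G := by ext k; simp [add_mul]
  map_mul' F G := by
    ext k
    simp only [PowerSeries.coeff_mk, PowerSeries.coeff_mul, map_sum, map_mul, Finset.sum_mul]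
    refine Finset.sum_congr rfl fun p hp => ?_
    rw [← Finset.HasAntidiagonal.mem_antidiagonal.mp hp, pow_add, mul_assoc, mul_assoc, ← mul_assoc (f _) (c ^ _),
      ((hc _).pow_right _).eq, mul_assoc]

theorem coeff_twist {A B : Type*} [Ring A] [Ring B] (f : A →+* B) (c : B)
    (hc : ∀ a, Commute (f a) c) (F : A⟦X⟧) (k : ℕ) :
    PowerSeries.coeff k (twist f c hc F) = f (PowerSeries.coeff k F) * c ^ k := by
  simp [twist]

variable {K A : Type*} [Field K] [Ring A]

/-- The series `x(X^δ Y)` in the outer variable `Y`, where `X` is the inner variable. -/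
def outer (δ : ℕ) : A⟦X⟧ →+* A⟦X⟧⟦X⟧ :=
  twist PowerSeries.C (PowerSeries.X ^ δ) fun a => by
    exact ((PowerSeries.commute_X _).pow_right δ)

/-- The series `f(z X^ε Y)`. -/
def scalar [Algebra K A] (ε : ℕ) (z : A) : K⟦X⟧ →+* A⟦X⟧⟦X⟧ :=
  twist (PowerSeries.C.comp (algebraMap K A)) (PowerSeries.C z * PowerSeries.X ^ ε) fun a => by
    refine Commute.mul_right ?_ ((PowerSeries.commute_X _).pow_right ε)
    exact Commute.map (Algebra.commutes a z) PowerSeries.C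

/-- The coefficient of `Y^k X^s`, for arbitrary integers `k` and `s`. -/
def dcoeff (G : A⟦X⟧⟦X⟧) (k s : ℤ) : A :=
  if 0 ≤ k ∧ 0 ≤ s then PowerSeries.coeff s.toNat (PowerSeries.coeff k.toNat G) else 0


theorem dcoeff_ext {G H : A⟦X⟧⟦X⟧} (h : ∀ k s, dcoeff G k s = dcoeff H k s) : G = H := by
  ext k s
  simpa [dcoeff] using h k s

theorem dcoeff_sum {ι : Type*} (t : Finset ι) (G : ι → A⟦X⟧⟦X⟧) (k s : ℤ) :
    dcoeff (∑ i ∈ t, G i) k s = ∑ i ∈ t, dcoeff (G i) k s := by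
  unfold dcoeff
  split_ifs <;> simp

theorem coeff_outer (δ k : ℕ) (x : A⟦X⟧) :
    PowerSeries.coeff k (outer δ x) =
      PowerSeries.C (PowerSeries.coeff k x) * PowerSeries.X ^ (δ * k) := by
  rw [outer, coeff_twist, pow_mul]

theorem dcoeff_C_mul_outer (δ : ℕ) (x y : A⟦X⟧) (k s : ℤ) :
    dcoeff (PowerSeries.C x * outer δ y) k s =
      zcoeff .plus (fun t => PowerSeries.coeff t x) (s - δ * k) *
        zcoeff .plus (fun t => PowerSeries.coeff t y) k := by
  unfold dcoeff zcoeff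
  by_cases hk : 0 ≤ k
  · lift k to ℕ using hk
    by_cases hs : 0 ≤ s
    · lift s to ℕ using hs
      simp only [Int.natCast_nonneg, and_self, if_true, Int.toNat_natCast,
        PowerSeries.coeff_C_mul, coeff_outer]
      rw [← mul_assoc, PowerSeries.coeff_mul_X_pow']
      by_cases h : δ * k ≤ s
      · rw [if_pos h, if_pos (by rw [sub_nonneg]; exact_mod_cast h), PowerSeries.coeff_mul_C]
        congr 2
        rw [← Nat.cast_mul, Int.toNat_sub]
      · rw [if_neg h, if_neg (by rw [sub_nonneg]; exact_mod_cast h), zero_mul]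
    · have : ¬ (0 ≤ s - δ * (k : ℤ)) := by
        have : (0 : ℤ) ≤ δ * (k : ℤ) := by positivity
        omega
      rw [if_neg fun h => hs h.2, if_neg this]
      simp
  · simp [hk]

theorem dcoeff_outer_mul_C (δ : ℕ) (x y : A⟦X⟧) (k s : ℤ) :
    dcoeff (outer δ y * PowerSeries.C x) k s =
      zcoeff .plus (fun t => PowerSeries.coeff t y) k *
        zcoeff .plus (fun t => PowerSeries.coeff t x) (s - δ * k) := by
  unfold dcoeff zcoeff
  by_cases hk : 0 ≤ k
  · lift k to ℕ using hk
    by_cases hs : 0 ≤ s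
    · lift s to ℕ using hs
      simp only [Int.natCast_nonneg, and_self, if_true, Int.toNat_natCast,
        PowerSeries.coeff_mul_C, coeff_outer]
      rw [mul_assoc, ← (PowerSeries.commute_X_pow x _).eq, PowerSeries.coeff_C_mul,
        PowerSeries.coeff_mul_X_pow']
      by_cases h : δ * k ≤ s
      · rw [if_pos h, if_pos (by rw [sub_nonneg]; exact_mod_cast h)]
        congr 2
        rw [← Nat.cast_mul, Int.toNat_sub]
      · rw [if_neg h, if_neg (by rw [sub_nonneg]; exact_mod_cast h), mul_zero]
    · have : ¬ (0 ≤ s - δ * (k : ℤ)) := by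
        have : (0 : ℤ) ≤ δ * (k : ℤ) := by positivity
        omega
      rw [if_neg fun h => hs h.2, if_neg this]
      simp
  · simp [hk]

variable [Algebra K A]

theorem coeff_scalar (ε t : ℕ) (z : A) (f : K⟦X⟧) :
    PowerSeries.coeff t (scalar ε z f) =
      PowerSeries.C (algebraMap K A (PowerSeries.coeff t f) * z ^ t) * PowerSeries.X ^ (ε * t) := by
  rw [scalar, coeff_twist, Commute.mul_pow ((PowerSeries.commute_X _).pow_right ε), ← pow_mul,
    RingHom.comp_apply, map_mul, map_pow, mul_assoc]

/-- This lets the entries of R̄ on the right side of an exchange relation be moved to the left,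
where their action on coefficients is computed by `dcoeff_scalar_mul`. -/
theorem scalar_commute (ε : ℕ) {z : A} (hz : ∀ x, Commute z x) (f : K⟦X⟧) (G : A⟦X⟧⟦X⟧) :
    Commute (scalar ε z f) G := by
  have h : ∀ t H, Commute (PowerSeries.coeff t (scalar ε z f)) H := by
    intro t H
    rw [coeff_scalar]
    refine Commute.mul_left ?_ (PowerSeries.commute_X_pow H _).symm
    rw [map_mul]
    refine Commute.mul_left ?_ ?_
    · ext s
      rw [PowerSeries.coeff_C_mul, PowerSeries.coeff_mul_C, Algebra.commutes]
    · ext s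
      rw [PowerSeries.coeff_C_mul, PowerSeries.coeff_mul_C, ((hz _).pow_left t).eq]
  ext1 k
  rw [PowerSeries.coeff_mul, PowerSeries.coeff_mul, ← Finset.Nat.sum_antidiagonal_swap]
  exact Finset.sum_congr rfl fun p _ => h _ _

/-- The sum over all t agrees with the finite Cauchy product because `dcoeff` is 0 at negative
exponents, which removes every t > k. -/
theorem dcoeff_scalar_mul (ε : ℕ) (z : A) (f : K⟦X⟧) (G : A⟦X⟧⟦X⟧) (k s : ℤ) :
    dcoeff (scalar ε z f * G) k s =
      ∑ᶠ t : ℕ, PowerSeries.coeff t f • (z ^ t * dcoeff G (k - t) (s - ε * t)) := by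
  by_cases hks : 0 ≤ k ∧ 0 ≤ s
  · obtain ⟨hk, hs⟩ := hks
    lift k to ℕ using hk
    lift s to ℕ using hs
    rw [finsum_eq_sum_of_support_subset (s := Finset.range (k + 1))]
    · rw [dcoeff, if_pos (by simp), Int.toNat_natCast, Int.toNat_natCast, PowerSeries.coeff_mul,
        Finset.Nat.sum_antidiagonal_eq_sum_range_succ
          (fun i j => PowerSeries.coeff i (scalar ε z f) * PowerSeries.coeff j G), map_sum]
      refine Finset.sum_congr rfl fun t ht => ?_
      have ht : t ≤ k := Nat.lt_succ_iff.mp (Finset.mem_range.mp ht)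
      rw [coeff_scalar, mul_assoc, PowerSeries.coeff_C_mul, PowerSeries.coeff_X_pow_mul', dcoeff,
        Algebra.smul_def, mul_assoc]
      congr 2
      by_cases h : ε * t ≤ s
      · rw [if_pos h, if_pos ⟨by omega, by rw [sub_nonneg]; exact_mod_cast h⟩]
        rw [← Nat.cast_sub ht, Int.toNat_natCast]
        rw [← Nat.cast_mul, Int.toNat_sub]
      · rw [if_neg h, if_neg fun h' => h (by have := h'.2; rw [sub_nonneg] at this; exact_mod_cast this)]
    · intro t ht
      by_contra hc
      have : ¬ (0 ≤ (k : ℤ) - t) := by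
        simp only [Finset.coe_range, Set.mem_Iio] at hc
        omega
      exact ht (by beta_reduce; rw [dcoeff, if_neg fun h => this h.1, mul_zero, smul_zero])
  · rw [dcoeff, if_neg hks]
    symm
    refine (finsum_congr fun t => ?_).trans finsum_zero
    have : ¬ (0 ≤ k - (t : ℤ) ∧ 0 ≤ s - ε * (t : ℤ)) := by
      rintro ⟨h1, h2⟩
      have : (0 : ℤ) ≤ ε * (t : ℤ) := by positivity
      exact hks ⟨by omega, by omega⟩
    rw [dcoeff, if_neg this, mul_zero, smul_zero]

theorem zcoeff_minus {A : Type*} [Zero A] (g : ℕ → A) (a : ℤ) :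
    zcoeff .minus g a = zcoeff .plus g (-a) := by
  simp [zcoeff]

/-- A realization of the series in `u`, `v` occurring in an exchange relation
`R̄(z u / v) X₁(u) Y₂(v) = Y₂(v) X₁(u) R̄(z' u / v)` as elements of a ring: `left` and `right` are
the expansions in `u` and `v`, `scal` and `scal'` those in `z u / v` and `z' u / v`, and `cf`
extracts coefficients. -/
structure SeriesModel (K : Type*) [Field K] {A : Type*} [Ring A] [Algebra K A] (s s' : Sgn)
    (z z' : A) where
  left : A⟦X⟧ →+* A⟦X⟧⟦X⟧
  right : A⟦X⟧ →+* A⟦X⟧⟦X⟧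
  scal : K⟦X⟧ →+* A⟦X⟧⟦X⟧
  scal' : K⟦X⟧ →+* A⟦X⟧⟦X⟧
  cf : A⟦X⟧⟦X⟧ → ℤ → ℤ → A
  cf_ext : ∀ {G H}, (∀ a b, cf G a b = cf H a b) → G = H
  cf_sum : ∀ {ι : Type} (t : Finset ι) (G : ι → A⟦X⟧⟦X⟧) (a b : ℤ),
    cf (∑ i ∈ t, G i) a b = ∑ i ∈ t, cf (G i) a b
  cf_left_mul_right : ∀ x y a b, cf (left x * right y) a b =
    zcoeff s (fun t => PowerSeries.coeff t x) a * zcoeff s' (fun t => PowerSeries.coeff t y) b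
  cf_right_mul_left : ∀ x y a b, cf (right y * left x) a b =
    zcoeff s' (fun t => PowerSeries.coeff t y) b * zcoeff s (fun t => PowerSeries.coeff t x) a
  cf_scal : ∀ f G a b, cf (scal f * G) a b = actCoeff f z (cf G) a b
  cf_scal' : ∀ f G a b, cf (G * scal' f) a b = actCoeff f z' (cf G) a b

/-- The realization for two series in `u` and `v`. -/
def plusModel : SeriesModel K (A := A) .plus .plus 1 1 where
  left := outer 1
  right := PowerSeries.C
  scal := scalar 0 1
  scal' := scalar 0 1
  -- u = XY and v = X, so u/v = Y.
  cf G a b := dcoeff G a (a + b)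
  cf_ext h := dcoeff_ext fun k s => by simpa using h k (s - k)
  cf_sum t G a b := dcoeff_sum t G _ _
  cf_left_mul_right x y a b := by simp [dcoeff_outer_mul_C]
  cf_right_mul_left x y a b := by simp [dcoeff_C_mul_outer]
  cf_scal f G a b := by
    rw [dcoeff_scalar_mul, actCoeff]
    refine finsum_congr fun t => ?_
    congr 3
    push_cast
    ring
  cf_scal' f G a b := by
    rw [← (scalar_commute 0 (fun x => Commute.one_left x) f G).eq, dcoeff_scalar_mul, actCoeff]
    refine finsum_congr fun t => ?_
    congr 3
    push_cast
    ring

/-- The realization for two series in `u⁻¹` and `v⁻¹`. -/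
def minusModel : SeriesModel K (A := A) .minus .minus 1 1 where
  left := PowerSeries.C
  right := outer 1
  scal := scalar 0 1
  scal' := scalar 0 1
  -- u⁻¹ = X and v⁻¹ = XY, so u/v = Y.
  cf G a b := dcoeff G (-b) (-(a + b))
  cf_ext h := dcoeff_ext fun k s => by simpa using h (k - s) (-k)
  cf_sum t G a b := dcoeff_sum t G _ _
  cf_left_mul_right x y a b := by simp [dcoeff_C_mul_outer, zcoeff_minus]
  cf_right_mul_left x y a b := by simp [dcoeff_outer_mul_C, zcoeff_minus]
  cf_scal f G a b := by
    rw [dcoeff_scalar_mul, actCoeff]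
    refine finsum_congr fun t => ?_
    congr 3 <;> push_cast <;> ring
  cf_scal' f G a b := by
    rw [← (scalar_commute 0 (fun x => Commute.one_left x) f G).eq, dcoeff_scalar_mul, actCoeff]
    refine finsum_congr fun t => ?_
    congr 3 <;> push_cast <;> ring

/-- The realization for a series in `u` and a series in `v⁻¹`. -/
def mixedModel (z z' : A) (hz' : ∀ x, Commute z' x) :
    SeriesModel K (A := A) .plus .minus z z' where
  left := PowerSeries.C
  right := outer 0
  scal := scalar 1 z
  scal' := scalar 1 z'
  -- u = X and v⁻¹ = Y, so u/v = XY.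
  cf G a b := dcoeff G (-b) a
  cf_ext h := dcoeff_ext fun k s => by simpa using h s (-k)
  cf_sum t G a b := dcoeff_sum t G _ _
  cf_left_mul_right x y a b := by simp [dcoeff_C_mul_outer, zcoeff_minus]
  cf_right_mul_left x y a b := by simp [dcoeff_outer_mul_C, zcoeff_minus]
  cf_scal f G a b := by
    rw [dcoeff_scalar_mul, actCoeff]
    refine finsum_congr fun t => ?_
    congr 3 <;> push_cast <;> ring
  cf_scal' f G a b := by
    rw [← (scalar_commute 1 hz' f G).eq, dcoeff_scalar_mul, actCoeff]
    refine finsum_congr fun t => ?_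
    congr 3 <;> push_cast <;> ring

/-- The coefficients of a matrix of series, extended to all integers. -/
def zser (s : Sgn) {I : Type*} (L : I → I → A⟦X⟧) (i j : I) (a : ℤ) : A :=
  zcoeff s (fun t => PowerSeries.coeff t (L i j)) a

/-- The bridge between the coefficientwise relations of the presentation and a single identity in a
ring, where elimination applies. -/
theorem SeriesModel.rtt_iff {s s' : Sgn} {z z' : A} (M : SeriesModel K s s' z z') (q : K) (n : ℕ)
    (L L' : Fin (2 * n) → Fin (2 * n) → A⟦X⟧) (i k j l : Fin (2 * n)) :
    (∀ a b, rttLeft q n z (zser s L) (zser s' L') i k j l a b =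
      rttRight q n z' (zser s L) (zser s' L') i k j l a b) ↔
    ∑ p, ∑ r, M.scal (Rbar q n (i, k) (p, r)) * (M.left (L p j) * M.right (L' r l)) =
      ∑ p, ∑ r, (M.right (L' k r) * M.left (L i p)) * M.scal' (Rbar q n (p, r) (j, l)) := by
  have h1 : ∀ a b, M.cf (∑ p, ∑ r, M.scal (Rbar q n (i, k) (p, r)) *
      (M.left (L p j) * M.right (L' r l))) a b =
      rttLeft q n z (zser s L) (zser s' L') i k j l a b := fun a b => by
    simp only [M.cf_sum, M.cf_scal, rttLeft, zser]
    simp only [actCoeff, M.cf_left_mul_right]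
  have h2 : ∀ a b, M.cf (∑ p, ∑ r, (M.right (L' k r) * M.left (L i p)) *
      M.scal' (Rbar q n (p, r) (j, l))) a b =
      rttRight q n z' (zser s L) (zser s' L') i k j l a b := fun a b => by
    simp only [M.cf_sum, M.cf_scal', rttRight, zser]
    simp only [actCoeff, M.cf_right_mul_left]
  refine ⟨fun h => M.cf_ext fun a b => by rw [h1, h2, h], fun h a b => by rw [← h1, ← h2, h]⟩

/-- The defining exchange relations pass to the quasideterminants. -/
theorem SeriesModel.rtt_reduce {s s' : Sgn} {z z' : A} (M : SeriesModel K s s' z z') {q : K}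
    (hq : q ≠ 0) {r n : ℕ} (h : r + 1 = n) (L L' : Fin (2 * n) → Fin (2 * n) → A⟦X⟧) {a b : A⟦X⟧}
    (ha : a * L (firstIdx h 0) (firstIdx h 0) = 1) (ha' : L (firstIdx h 0) (firstIdx h 0) * a = 1)
    (hb : b * L' (firstIdx h 0) (firstIdx h 0) = 1)
    (hb' : L' (firstIdx h 0) (firstIdx h 0) * b = 1)
    (hrel : ∀ i k j l a b, rttLeft q n z (zser s L) (zser s' L') i k j l a b =
      rttRight q n z' (zser s L) (zser s' L') i k j l a b)
    (S S' : Fin (2 * r) → Fin (2 * r) → A⟦X⟧)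
    (hS : ∀ i j, S i j = L (shiftIdx h i) (shiftIdx h j) -
      L (shiftIdx h i) (firstIdx h 0) * a * L (firstIdx h 0) (shiftIdx h j))
    (hS' : ∀ i j, S' i j = L' (shiftIdx h i) (shiftIdx h j) -
      L' (shiftIdx h i) (firstIdx h 0) * b * L' (firstIdx h 0) (shiftIdx h j))
    (i k j l : Fin (2 * r)) (c d : ℤ) :
    rttLeft q r z (zser s S) (zser s' S') i k j l c d =
      rttRight q r z' (zser s S) (zser s' S') i k j l c d := by
  refine (M.rtt_iff q r S S' i k j l).mpr ?_ c d
  refine exchange_Rbar hq h M.scal M.scal' (fun i j => M.left (L i j)) (fun i j => M.right (L' i j))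
    (a := M.left a) (b := M.right b) (by rw [← map_mul, ha, map_one])
    (by rw [← map_mul, ha', map_one]) (by rw [← map_mul, hb, map_one])
    (by rw [← map_mul, hb', map_one])
    (fun i k j l => (M.rtt_iff q n L L' i k j l).mp (hrel i k j l))
    (fun i j => M.left (S i j)) (fun i j => M.right (S' i j)) ?_ ?_ i k j l
  · intro i j; simp only [hS, map_sub, map_mul]
  · intro i j; simp only [hS', map_sub, map_mul]

end Series

/-! ### Schur complements over noncommutative rings -/

section Schur

variable {S : Type*} [Ring S] {I : Type*}

/-- The square block of `L` with rows and columns given by `f`. -/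
def block (L : I → I → S) {m : ℕ} (f : Fin m → I) : Matrix (Fin m) (Fin m) S :=
  Matrix.of fun a b => L (f a) (f b)

/-- The quasideterminant of the bordered block with rows `f, i` and columns `f, j`. -/
def schur (L : I → I → S) {m : ℕ} (f : Fin m → I) (i j : I) : S :=
  L i j - ∑ b, ∑ a, L i (f b) * (Ring.inverse (block L f) : Matrix _ _ S) b a * L (f a) j

theorem quasidet_last {m : ℕ} (L : I → I → S) (f : Fin m → I) (i j : I) :
    quasidet (Matrix.of fun a b => L (Fin.snoc (α := fun _ => I) f i a)
      (Fin.snoc (α := fun _ => I) f j b)) (Fin.last m) (Fin.last m) = schur L f i j := by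
  have hsub : (Matrix.of fun a b => L (Fin.snoc (α := fun _ => I) f i a)
      (Fin.snoc (α := fun _ => I) f j b)).submatrix (Fin.last m).succAbove
        (Fin.last m).succAbove = block L f := by
    ext a b
    simp [block, Fin.succAbove_last]
  rw [quasidet, hsub]
  simp [schur, Fin.succAbove_last]

theorem exists_solution {L : I → I → S} {m : ℕ} {f : Fin m → I} (hu : IsUnit (block L f))
    (j : I) : ∃ y : Fin m → S, ∀ a, ∑ b, L (f a) (f b) * y b = L (f a) j := by
  refine ⟨(Ring.inverse (block L f)).mulVec fun a => L (f a) j, fun a => ?_⟩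
  have := congrFun (Matrix.mulVec_mulVec (fun a => L (f a) j) (block L f)
    (Ring.inverse (block L f))) a
  rw [Ring.mul_inverse_cancel _ hu, Matrix.one_mulVec] at this
  exact this

/-- Any solution of the linear system for column j computes the Schur complement, so later arguments
exhibit solutions instead of manipulating inverse matrices. -/
theorem schur_eq_of_solution {L : I → I → S} {m : ℕ} {f : Fin m → I} (hu : IsUnit (block L f))
    {j : I} {y : Fin m → S} (hy : ∀ a, ∑ b, L (f a) (f b) * y b = L (f a) j) (i : I) :
    schur L f i j = L i j - ∑ b, L i (f b) * y b := by
  have h1 : (block L f).mulVec y = fun a => L (f a) j := funext hy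
  have h2 : (Ring.inverse (block L f)).mulVec (fun a => L (f a) j) = y := by
    rw [← h1, Matrix.mulVec_mulVec, Ring.inverse_mul_cancel _ hu, Matrix.one_mulVec]
  rw [schur, ← h2]
  simp only [Matrix.mulVec, dotProduct, Finset.mul_sum, mul_assoc]

theorem schur_row_eq_zero {L : I → I → S} {m : ℕ} {f : Fin m → I} (hu : IsUnit (block L f))
    (a : Fin m) (j : I) : schur L f (f a) j = 0 := by
  obtain ⟨y, hy⟩ := exists_solution hu j
  rw [schur_eq_of_solution hu hy, hy, sub_self]

/-- Sylvester's identity: Schur complements can be taken in stages. -/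
theorem schur_schur {L : I → I → S} {l m : ℕ} {f : Fin l → I} {g : Fin m → I}
    (hf : IsUnit (block L f)) (hg : IsUnit (block (schur L f) g))
    (hfg : IsUnit (block L (Fin.append f g))) (i j : I) :
    schur (schur L f) g i j = schur L (Fin.append f g) i j := by
  choose Y hY using fun x => exists_solution hf x
  have hT : ∀ i x, schur L f i x = L i x - ∑ b, L i (f b) * Y x b :=
    fun i x => schur_eq_of_solution hf (hY x) i
  obtain ⟨y, hy⟩ := exists_solution hg j
  -- The solution for the combined block is y on the g-part and, on the f-part, the f-solution for
  -- column j corrected by those for the columns g c. On rows f the Schur complement vanishes; on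
  -- rows g the equation for y applies.
  have key : ∀ i, ∑ b, L i (Fin.append f g b) *
      (Fin.append (fun b => Y j b - ∑ c, Y (g c) b * y c) y : Fin (l + m) → S) b =
      L i j - schur L f i j + ∑ c, schur L f i (g c) * y c := by
    intro i
    simp only [Fin.sum_univ_add, Fin.append_left, Fin.append_right, hT, mul_sub, sub_mul,
      Finset.sum_sub_distrib, Finset.mul_sum, Finset.sum_mul, ← mul_assoc]
    rw [Finset.sum_comm]
    abel
  rw [schur_eq_of_solution hg hy, schur_eq_of_solution hfg (fun a => ?_), key]
  · abel
  · rw [key]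
    refine Fin.addCases (fun a => ?_) (fun a => ?_) a
    · simp [schur_row_eq_zero hf]
    · simp [hy]

theorem map_schur {S' : Type*} [Ring S'] (φ : S →+* S') {L : I → I → S} {m : ℕ} {f : Fin m → I}
    (hu : IsUnit (block L f)) (i j : I) :
    φ (schur L f i j) = schur (fun i j => φ (L i j)) f i j := by
  have hu' : IsUnit (block (fun i j => φ (L i j)) f) := hu.map φ.mapMatrix
  obtain ⟨y, hy⟩ := exists_solution hu j
  rw [schur_eq_of_solution hu hy, schur_eq_of_solution hu' (y := fun b => φ (y b))]
  · simp
  · intro a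
    rw [← hy]
    simp

theorem schur_zero (L : I → I → S) (f : Fin 0 → I) (i j : I) : schur L f i j = L i j := by
  simp [schur]

theorem schur_one {L : I → I → S} {f : Fin 1 → I} (hu : IsUnit (block L f)) {a : S}
    (ha : L (f 0) (f 0) * a = 1) (i j : I) :
    schur L f i j = L i j - L i (f 0) * a * L (f 0) j := by
  rw [schur_eq_of_solution hu (y := fun _ => a * L (f 0) j)]
  · simp [mul_assoc]
  · intro b
    simp [Subsingleton.elim b 0, ← mul_assoc, ha]

end Schur

/-! ### Invertibility of block matrices and of matrices of power series. -/

section Units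

variable {S : Type*} [Ring S]

/-- The block LDU factorization: unipotent lower, block diagonal with the Schur complement,
unipotent upper. -/
theorem isUnit_fromBlocks {m n : Type*} [Fintype m] [Fintype n] [DecidableEq m] [DecidableEq n]
    {A A' : Matrix m m S} {B : Matrix m n S} {C : Matrix n m S} {D : Matrix n n S}
    (hA : A * A' = 1) (hA' : A' * A = 1) (hD : IsUnit (D - C * A' * B)) :
    IsUnit (Matrix.fromBlocks A B C D) := by
  obtain ⟨⟨E, E', hE, hE'⟩, rfl : E = _⟩ := hD
  have h1 : IsUnit (Matrix.fromBlocks 1 0 (C * A') 1 : Matrix (m ⊕ n) (m ⊕ n) S) :=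
    isUnit_iff_exists.mpr ⟨Matrix.fromBlocks 1 0 (-(C * A')) 1,
      by simp [Matrix.fromBlocks_multiply], by simp [Matrix.fromBlocks_multiply]⟩
  have h2 : IsUnit (Matrix.fromBlocks 1 (A' * B) 0 1 : Matrix (m ⊕ n) (m ⊕ n) S) :=
    isUnit_iff_exists.mpr ⟨Matrix.fromBlocks 1 (-(A' * B)) 0 1,
      by simp [Matrix.fromBlocks_multiply], by simp [Matrix.fromBlocks_multiply]⟩
  have h3 : IsUnit (Matrix.fromBlocks A 0 0 (D - C * A' * B) : Matrix (m ⊕ n) (m ⊕ n) S) :=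
    isUnit_iff_exists.mpr ⟨Matrix.fromBlocks A' 0 0 E',
      by simp [Matrix.fromBlocks_multiply, hA, hE],
      by simp [Matrix.fromBlocks_multiply, hA', hE']⟩
  have : Matrix.fromBlocks A B C D = Matrix.fromBlocks 1 0 (C * A') 1 *
      Matrix.fromBlocks A 0 0 (D - C * A' * B) * Matrix.fromBlocks 1 (A' * B) 0 1 := by
    have e1 : A * (A' * B) = B := by rw [← Matrix.mul_assoc, hA, Matrix.one_mul]
    have e2 : C * A' * A = C := by rw [Matrix.mul_assoc, hA', Matrix.mul_one]
    simp only [Matrix.fromBlocks_multiply, Matrix.one_mul, Matrix.mul_one, Matrix.zero_mul,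
      Matrix.mul_zero, add_zero, zero_add, e1, e2, Matrix.mul_assoc C A' B, add_sub_cancel]
  rw [this]
  exact (h1.mul h3).mul h2

/-- A matrix of power series whose constant term is triangular with invertible diagonal entries
is invertible. -/
theorem isUnit_of_triangular {m : ℕ} (M : Matrix (Fin m) (Fin m) S⟦X⟧)
    (hdiag : ∀ i, IsUnit (PowerSeries.constantCoeff (M i i)))
    (htri : (∀ i j, i < j → PowerSeries.constantCoeff (M i j) = 0) ∨
      (∀ i j, i < j → PowerSeries.constantCoeff (M j i) = 0)) : IsUnit M := by
  induction m with
  | zero => exact isUnit_of_subsingleton M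
  | succ m ih =>
    obtain ⟨⟨A, A', hA, hA'⟩, rfl : A = _⟩ := ih (M.submatrix Fin.castSucc Fin.castSucc)
      (fun i => hdiag _) (htri.imp (fun h i j hij => h _ _ (by simpa using hij))
        fun h i j hij => h _ _ (by simpa using hij))
    let e : Fin m ⊕ Fin 1 ≃ Fin (m + 1) := finSumFinEquiv
    suffices h : IsUnit (M.submatrix e e) by
      have := h.map (Matrix.reindexRingEquiv S⟦X⟧ e)
      simpa using this
    have hblk : M.submatrix e e = Matrix.fromBlocks (M.submatrix Fin.castSucc Fin.castSucc)
        (M.submatrix Fin.castSucc fun _ => Fin.last m)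
        (M.submatrix (fun _ => Fin.last m) Fin.castSucc)
        (M.submatrix (fun _ => Fin.last m) fun _ => Fin.last m) := by
      ext (i | i) (j | j) <;> simp [e, Subsingleton.elim _ (0 : Fin 1)] <;> rfl
    rw [hblk]
    refine isUnit_fromBlocks hA hA' ?_
    set D := M.submatrix (fun _ : Fin 1 => Fin.last m) (fun _ : Fin 1 => Fin.last m) -
      M.submatrix (fun _ : Fin 1 => Fin.last m) Fin.castSucc * A' *
        M.submatrix Fin.castSucc (fun _ : Fin 1 => Fin.last m) with hD
    -- In the correction term one of the two outer factors has zero constant coefficients by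
    -- triangularity.
    have hc : PowerSeries.constantCoeff (D 0 0) =
        PowerSeries.constantCoeff (M (Fin.last m) (Fin.last m)) := by
      simp only [hD, Matrix.sub_apply, Matrix.submatrix_apply, map_sub, sub_eq_self]
      rcases htri with h | h
      · rw [Matrix.mul_apply, map_sum]
        exact Finset.sum_eq_zero fun i _ => by
          rw [map_mul, Matrix.submatrix_apply, h _ _ (Fin.castSucc_lt_last i), mul_zero]
      · rw [Matrix.mul_assoc, Matrix.mul_apply, map_sum]
        exact Finset.sum_eq_zero fun i _ => by
          rw [map_mul, Matrix.submatrix_apply, h _ _ (Fin.castSucc_lt_last i), zero_mul]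
    have hu : IsUnit (D 0 0) := PowerSeries.isUnit_iff_constantCoeff.mpr (hc ▸ hdiag _)
    obtain ⟨⟨x, y, hxy, hyx⟩, hx : x = D 0 0⟩ := hu
    rw [hx] at hxy hyx
    refine isUnit_iff_exists.mpr ⟨Matrix.of fun _ _ => y, ?_, ?_⟩ <;>
      · ext i j
        rw [Subsingleton.elim i 0, Subsingleton.elim j 0]
        simp [Matrix.mul_apply, hxy, hyx]

end Units

/-! ### Consequences of the defining relations -/

section Relations

variable {K : Type*} [Field K]

/-! ### Compatibility of exchange relations with algebra homomorphisms. -/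

section Map

variable {A A' : Type*} [Ring A] [Algebra K A] [Ring A'] [Algebra K A'] (φ : A →ₐ[K] A')

/-- The bound on F makes the support finite, so that `∑ᶠ` is a genuine sum that a homomorphism
preserves. -/
theorem map_actCoeff (f : K⟦X⟧) (z : A) (F : ℤ → ℤ → A) (a b : ℤ)
    (hF : ∃ N : ℕ, ∀ t : ℕ, N ≤ t → F (a - t) (b + t) = 0) :
    φ (actCoeff f z F a b) = actCoeff f (φ z) (fun a b => φ (F a b)) a b := by
  obtain ⟨N, hN⟩ := hF
  have hfin : (Function.support fun t : ℕ =>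
      PowerSeries.coeff t f • (z ^ t * F (a - t) (b + t))).Finite := by
    refine (Set.finite_Iio N).subset fun t ht => ?_
    by_contra hc
    exact ht (by beta_reduce; rw [hN t (not_lt.mp hc), mul_zero, smul_zero])
  have := (φ : A →+ A').map_finsum hfin
  simp only [AddMonoidHom.coe_coe, map_smul, map_mul, map_pow] at this
  exact this

/-- Multiplication by (u/v)^t lowers the exponent of u and raises that of v, so it suffices that X
has no negative powers or Y no positive ones. This covers the sign pairs ++, -- and +-. -/
theorem exists_vanishing_bound {X Y : ℤ → A}
    (h : (∀ a, a < 0 → X a = 0) ∨ (∀ b, 0 < b → Y b = 0)) (a b : ℤ) :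
    ∃ N : ℕ, ∀ t : ℕ, N ≤ t → X (a - t) = 0 ∨ Y (b + t) = 0 := by
  rcases h with h | h
  · exact ⟨a.toNat + 1, fun t ht => Or.inl (h _ (by omega))⟩
  · exact ⟨(-b).toNat + 1, fun t ht => Or.inr (h _ (by omega))⟩

theorem map_rttLeft (q : K) (n : ℕ) (z : A) (X Y : Fin (2 * n) → Fin (2 * n) → ℤ → A)
    (h : (∀ i j a, a < 0 → X i j a = 0) ∨ (∀ i j b, 0 < b → Y i j b = 0))
    (i k j l : Fin (2 * n)) (a b : ℤ) :
    φ (rttLeft q n z X Y i k j l a b) =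
      rttLeft q n (φ z) (fun i j a => φ (X i j a)) (fun i j a => φ (Y i j a)) i k j l a b := by
  simp only [rttLeft, map_sum]
  refine Finset.sum_congr rfl fun p _ => Finset.sum_congr rfl fun r _ => ?_
  rw [map_actCoeff]
  · simp only [map_mul]
  · obtain ⟨N, hN⟩ := exists_vanishing_bound (h.imp (fun h => h p j) fun h => h r l) a b
    exact ⟨N, fun t ht => by rcases hN t ht with h | h <;> simp [h]⟩

theorem map_rttRight (q : K) (n : ℕ) (z : A) (X Y : Fin (2 * n) → Fin (2 * n) → ℤ → A)
    (h : (∀ i j a, a < 0 → X i j a = 0) ∨ (∀ i j b, 0 < b → Y i j b = 0))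
    (i k j l : Fin (2 * n)) (a b : ℤ) :
    φ (rttRight q n z X Y i k j l a b) =
      rttRight q n (φ z) (fun i j a => φ (X i j a)) (fun i j a => φ (Y i j a)) i k j l a b := by
  simp only [rttRight, map_sum]
  refine Finset.sum_congr rfl fun p _ => Finset.sum_congr rfl fun r _ => ?_
  rw [map_actCoeff]
  · simp only [map_mul]
  · obtain ⟨N, hN⟩ := exists_vanishing_bound (h.imp (fun h => h i p) fun h => h k r) a b
    exact ⟨N, fun t ht => by rcases hN t ht with h | h <;> simp [h]⟩

theorem map_zcoeff (s : Sgn) (g : ℕ → A) (a : ℤ) :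
    φ (zcoeff s g a) = zcoeff s (fun k => φ (g k)) a := by
  cases s <;> simp only [zcoeff] <;> split_ifs <;> simp

theorem zcoeff_plus_of_neg (g : ℕ → A) {a : ℤ} (ha : a < 0) : zcoeff .plus g a = 0 := by
  simp [zcoeff, not_le.mpr ha]

theorem zcoeff_minus_of_pos (g : ℕ → A) {a : ℤ} (ha : 0 < a) : zcoeff .minus g a = 0 := by
  simp [zcoeff, not_le.mpr ha]

/-- The two sides of an exchange relation between free generating series are mapped to the two
sides of the relation between the image series. -/
theorem map_rtt_fell {n : ℕ} (φ : FreeAlgebra K (Gen n) →ₐ[K] A) (q : K) (s s' : Sgn)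
    (h : s = .plus ∨ s' = .minus) (L : Sgn → Fin (2 * n) → Fin (2 * n) → A⟦X⟧)
    (hL : ∀ s i j a, φ (fgen K (.ell s i j a)) = PowerSeries.coeff a (L s i j))
    (z : FreeAlgebra K (Gen n)) (i k j l : Fin (2 * n)) (a b : ℤ) :
    φ (rttLeft q n z (fell K s) (fell K s') i k j l a b) =
        rttLeft q n (φ z) (zser s (L s)) (zser s' (L s')) i k j l a b ∧
      φ (rttRight q n z (fell K s) (fell K s') i k j l a b) =
        rttRight q n (φ z) (zser s (L s)) (zser s' (L s')) i k j l a b := by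
  have hv : (∀ i j a, a < 0 → fell K (n := n) s i j a = 0) ∨
      (∀ i j b, 0 < b → fell K (n := n) s' i j b = 0) := by
    rcases h with rfl | rfl
    · exact Or.inl fun i j a ha => zcoeff_plus_of_neg _ ha
    · exact Or.inr fun i j a ha => zcoeff_minus_of_pos _ ha
  have hf : ∀ s : Sgn, (fun i j a => φ (fell K s i j a)) = zser s (L s) := by
    intro s
    funext i j a
    simp only [fell, zser, map_zcoeff, hL]
  constructor
  · rw [map_rttLeft φ q n z _ _ hv, hf, hf]
  · rw [map_rttRight φ q n z _ _ hv, hf, hf]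

end Map

/-! ### Relations and invertible elements in U(R̄). -/

variable {q : K} {n : ℕ}

theorem mk_rel {x y : FreeAlgebra K (Gen n)} (h : Rel q n x y) :
    RingQuot.mkAlgHom K (Rel q n) x = RingQuot.mkAlgHom K (Rel q n) y :=
  RingQuot.mkAlgHom_rel K h

theorem qHalf_mul_qHalfInv : gen q (.qHalf : Gen n) * gen q .qHalfInv = 1 := by
  simpa [gen] using mk_rel (q := q) (n := n) .qHalf_mul_inv

theorem qHalfInv_mul_qHalf : gen q (.qHalfInv : Gen n) * gen q .qHalf = 1 := by
  simpa [gen] using mk_rel (q := q) (n := n) .qHalf_inv_mul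

theorem qHalf_commute (x : URbar q n) : Commute (gen q .qHalf) x := by
  obtain ⟨y, rfl⟩ := RingQuot.mkAlgHom_surjective K (Rel q n) x
  induction y using FreeAlgebra.induction with
  | grade0 r => rw [AlgHom.commutes]; exact (Algebra.commutes r _).symm
  | grade1 g => simpa [gen, fgen, Commute, SemiconjBy] using mk_rel (q := q) (.qHalf_central g)
  | mul a b ha hb => rw [map_mul]; exact ha.mul_right hb
  | add a b ha hb => rw [map_add]; exact ha.add_right hb

theorem qHalfInv_commute (x : URbar q n) : Commute (gen q .qHalfInv) x := by
  have h := (qHalf_commute x).eq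
  calc gen q .qHalfInv * x = gen q .qHalfInv * x * (gen q .qHalf * gen q .qHalfInv) := by
        rw [qHalf_mul_qHalfInv, mul_one]
    _ = gen q .qHalfInv * (x * gen q .qHalf) * gen q .qHalfInv := by simp only [mul_assoc]
    _ = gen q .qHalfInv * gen q .qHalf * (x * gen q .qHalfInv) := by
        rw [← h]; simp only [mul_assoc]
    _ = x * gen q .qHalfInv := by rw [qHalfInv_mul_qHalf, one_mul]

theorem coeff_lser (s : Sgn) (i j : Fin (2 * n)) (a : ℕ) :
    PowerSeries.coeff a (lser q s i j) = gen q (.ell s i j a) :=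
  PowerSeries.coeff_mk _ _

theorem constantCoeff_lser (s : Sgn) (i j : Fin (2 * n)) :
    PowerSeries.constantCoeff (lser q s i j) = gen q (.ell s i j 0) := by
  rw [← PowerSeries.coeff_zero_eq_constantCoeff_apply, coeff_lser]

theorem gen_plus_zero {i j : Fin (2 * n)} (h : i < j) : gen q (.ell .plus i j 0) = 0 := by
  simpa [gen] using mk_rel (q := q) (.plus_zero i j h)

theorem gen_minus_zero {i j : Fin (2 * n)} (h : i < j) : gen q (.ell .minus j i 0) = 0 := by
  simpa [gen] using mk_rel (q := q) (.minus_zero i j h)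

theorem gen_plus_mul_minus (i : Fin (2 * n)) :
    gen q (.ell .plus i i 0) * gen q (.ell .minus i i 0) = 1 := by
  simpa [gen] using mk_rel (q := q) (.plus_mul_minus i)

theorem gen_minus_mul_plus (i : Fin (2 * n)) :
    gen q (.ell .minus i i 0) * gen q (.ell .plus i i 0) = 1 := by
  simpa [gen] using mk_rel (q := q) (.minus_mul_plus i)

theorem isUnit_gen_diag (s : Sgn) (i : Fin (2 * n)) : IsUnit (gen q (.ell s i i 0)) := by
  cases s
  · exact isUnit_iff_exists.mpr ⟨_, gen_plus_mul_minus i, gen_minus_mul_plus i⟩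
  · exact isUnit_iff_exists.mpr ⟨_, gen_minus_mul_plus i, gen_plus_mul_minus i⟩

theorem isUnit_block_lser (s : Sgn) {m : ℕ} {f : Fin m → Fin (2 * n)} (hf : StrictMono f) :
    IsUnit (block (lser q s) f) := by
  refine isUnit_of_triangular _ (fun i => ?_) ?_
  · simpa [block, constantCoeff_lser] using isUnit_gen_diag s (f i)
  · cases s
    · exact Or.inl fun i j hij => by simp [block, constantCoeff_lser, gen_plus_zero (hf hij)]
    · exact Or.inr fun i j hij => by simp [block, constantCoeff_lser, gen_minus_zero (hf hij)]

theorem rtt_same_lser (s : Sgn) (i k j l : Fin (2 * n)) (a b : ℤ) :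
    rttLeft q n 1 (zser s (lser q s)) (zser s (lser q s)) i k j l a b =
      rttRight q n 1 (zser s (lser q s)) (zser s (lser q s)) i k j l a b := by
  have h := map_rtt_fell (RingQuot.mkAlgHom K (Rel q n)) q s s (by cases s <;> simp) (lser q)
    (fun s i j a => (coeff_lser s i j a).symm) 1 i k j l a b
  rw [map_one] at h
  rw [← h.1, ← h.2, mk_rel (.rtt_same s i k j l a b)]

theorem rtt_mixed_lser (i k j l : Fin (2 * n)) (a b : ℤ) :
    rttLeft q n (gen q .qHalf ^ 2) (zser .plus (lser q .plus)) (zser .minus (lser q .minus))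
        i k j l a b =
      rttRight q n (gen q .qHalfInv ^ 2) (zser .plus (lser q .plus))
        (zser .minus (lser q .minus)) i k j l a b := by
  have h := fun z => map_rtt_fell (RingQuot.mkAlgHom K (Rel q n)) q .plus .minus (Or.inl rfl)
    (lser q) (fun s i j a => (coeff_lser s i j a).symm) z i k j l a b
  have h1 := (h (fgen K .qHalf ^ 2)).1
  have h2 := (h (fgen K .qHalfInv ^ 2)).2
  rw [map_pow] at h1 h2
  exact h1.symm.trans ((mk_rel (.rtt_mixed i k j l a b)).trans h2)

/-! ### The reduction maps -/

theorem firstIdx_strictMono {r m n : ℕ} (h : r + m = n) : StrictMono (firstIdx (m := m) h) :=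
  fun _ _ hab => hab

theorem leadingBlock_isUnit (q : K) {r m n : ℕ} (h : r + m = n) (s : Sgn) :
    IsUnit (leadingBlock q h s) :=
  isUnit_block_lser s (firstIdx_strictMono h)

/-- The quasideterminants of the bordered leading blocks. -/
def redSeries (q : K) {r m n : ℕ} (h : r + m = n) (s : Sgn) (i j : Fin (2 * r)) :
    (URbar q n)⟦X⟧ :=
  schur (lser q s) (firstIdx h) (shiftIdx h i) (shiftIdx h j)

theorem isReduction_iff {r m n : ℕ} (h : r + m = n) (ψ : URbar q r →ₐ[K] URbar q n) :
    IsReduction q h ψ ↔ ψ (gen q .qHalf) = gen q .qHalf ∧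
      ∀ s i j a, ψ (gen q (.ell s i j a)) = PowerSeries.coeff a (redSeries q h s i j) := by
  refine and_congr_right fun _ => forall_congr' fun s => forall_congr' fun i =>
    forall_congr' fun j => ?_
  rw [show quasidet (borderedBlock q h s (shiftIdx h i) (shiftIdx h j)) (Fin.last m) (Fin.last m)
    = redSeries q h s i j from quasidet_last _ _ _ _, PowerSeries.ext_iff]
  refine forall_congr' fun a => ?_
  rw [PowerSeries.coeff_map, coeff_lser]
  rfl

theorem algHom_ext_gen {A : Type*} [Ring A] [Algebra K A] {φ ψ : URbar q n →ₐ[K] A}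
    (h : ∀ g, φ (gen q g) = ψ (gen q g)) : φ = ψ := by
  refine RingQuot.ringQuot_ext' K φ ψ ?_
  apply FreeAlgebra.hom_ext
  funext g
  exact h g

theorem IsReduction.unique {r m n : ℕ} {h : r + m = n} {ψ ψ' : URbar q r →ₐ[K] URbar q n}
    (hψ : IsReduction q h ψ) (hψ' : IsReduction q h ψ') : ψ = ψ' := by
  rw [isReduction_iff] at hψ hψ'
  apply algHom_ext_gen
  rintro (_ | _ | ⟨s, i, j, a⟩)
  · rw [hψ.1, hψ'.1]
  -- A reduction prescribes only the image of q^{c/2}; that of its inverse follows from uniqueness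
  -- of inverses.
  · refine left_inv_eq_right_inv (a := gen q .qHalf) ?_ ?_
    · rw [← hψ.1, ← map_mul, qHalfInv_mul_qHalf, map_one]
    · rw [← hψ'.1, ← map_mul, qHalf_mul_qHalfInv, map_one]
  · rw [hψ.2, hψ'.2]

/-- A homomorphism commutes with Schur complements of invertible blocks, so the composite yields a
Schur complement of Schur complements, which Sylvester's identity collapses. -/
theorem isReduction_comp {p r n l m : ℕ} {hm : p + m = r} {hl : r + l = n}
    (hlm : p + (l + m) = n) {ψm : URbar q p →ₐ[K] URbar q r} {ψl : URbar q r →ₐ[K] URbar q n}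
    (hψm : IsReduction q hm ψm) (hψl : IsReduction q hl ψl) :
    IsReduction q hlm (ψl.comp ψm) := by
  rw [isReduction_iff] at hψm hψl ⊢
  refine ⟨by rw [AlgHom.comp_apply, hψm.1, hψl.1], fun s i j a => ?_⟩
  rw [AlgHom.comp_apply, hψm.2]
  let φ : (URbar q r)⟦X⟧ →+* (URbar q n)⟦X⟧ := PowerSeries.map (ψl : URbar q r →+* URbar q n)
  have hφ : ∀ i j, φ (lser q s i j) = redSeries q hl s i j := fun i j => by
    ext a
    rw [PowerSeries.coeff_map, coeff_lser]
    exact hψl.2 s i j a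
  have hu : IsUnit (block (lser q s) (firstIdx (m := m) hm) : Matrix _ _ (URbar q r)⟦X⟧) :=
    leadingBlock_isUnit q hm s
  have hfirst : Fin.append (firstIdx (m := l) hl) (shiftIdx hl ∘ firstIdx (m := m) hm) =
      firstIdx hlm := by
    funext x
    refine Fin.addCases (fun a => ?_) (fun a => ?_) x
    · rw [Fin.append_left]; rfl
    · rw [Fin.append_right]; rfl
  have hshift : ∀ i, shiftIdx hl (shiftIdx hm i) = shiftIdx hlm i := fun i =>
    Fin.ext (add_assoc l m i).symm
  have hmap : φ (redSeries q hm s i j) = redSeries q hlm s i j := by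
    rw [redSeries, map_schur φ hu]
    simp only [hφ]
    have hu' := hu.map φ.mapMatrix
    have hb : φ.mapMatrix (block (lser q s) (firstIdx (m := m) hm)) =
        block (schur (lser q s) (firstIdx (m := l) hl)) (shiftIdx hl ∘ firstIdx (m := m) hm) := by
      ext1 a b
      exact hφ _ _
    rw [hb] at hu'
    have := schur_schur (leadingBlock_isUnit q hl s) hu'
      (by rw [hfirst]; exact leadingBlock_isUnit q hlm s)
      (shiftIdx hl (shiftIdx hm i)) (shiftIdx hl (shiftIdx hm j))
    refine Eq.trans this ?_
    rw [hfirst, hshift, hshift, redSeries]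
  rw [← hmap, PowerSeries.coeff_map]
  rfl

theorem isReduction_id {n : ℕ} (h : n + 0 = n) :
    IsReduction q h (AlgHom.id K (URbar q n)) := by
  rw [isReduction_iff]
  refine ⟨rfl, fun s i j a => ?_⟩
  have hs : ∀ i : Fin (2 * n), shiftIdx h i = i := fun i => Fin.ext (zero_add _)
  rw [redSeries, schur_zero, hs, hs, coeff_lser]
  rfl

/-- The images of the generators under the reduction map. -/
def redGen (q : K) {r m n : ℕ} (h : r + m = n) : Gen r → URbar q n
  | .qHalf => gen q .qHalf
  | .qHalfInv => gen q .qHalfInv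
  | .ell s i j a => PowerSeries.coeff a (redSeries q h s i j)

theorem lift_redGen (q : K) {r m n : ℕ} (h : r + m = n) (g : Gen r) :
    FreeAlgebra.lift K (redGen q h) (fgen K g) = redGen q h g :=
  FreeAlgebra.lift_ι_apply _ _

theorem exists_firstEntry_inverse (q : K) {r n : ℕ} (h : r + 1 = n) (s : Sgn) :
    ∃ a : (URbar q n)⟦X⟧, lser q s (firstIdx h 0) (firstIdx h 0) * a = 1 ∧
      a * lser q s (firstIdx h 0) (firstIdx h 0) = 1 := by
  have hu : IsUnit (lser q s (firstIdx h 0) (firstIdx h 0)) :=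
    PowerSeries.isUnit_iff_constantCoeff.mpr
      (by rw [constantCoeff_lser]; exact isUnit_gen_diag s _)
  exact isUnit_iff_exists.mp hu

/-- The correction ℓ_{i1} ℓ_{11}⁻¹ ℓ_{1j} has zero constant term, since ℓ⁺_{1j}[0] = 0 and
ℓ⁻_{i1}[0] = 0 for i, j > 1. Hence all relations between zero modes are inherited. -/
theorem coeff_zero_redSeries (q : K) {r n : ℕ} (h : r + 1 = n) (s : Sgn) (i j : Fin (2 * r)) :
    PowerSeries.coeff 0 (redSeries q h s i j) =
      gen q (.ell s (shiftIdx h i) (shiftIdx h j) 0) := by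
  obtain ⟨a, ha, -⟩ := exists_firstEntry_inverse q h s
  have hlt : ∀ i : Fin (2 * r), firstIdx h 0 < shiftIdx h i := fun i => by
    simp only [firstIdx, shiftIdx, Fin.lt_def, Fin.val_zero]
    omega
  rw [redSeries, schur_one (leadingBlock_isUnit q h s) ha,
    PowerSeries.coeff_zero_eq_constantCoeff_apply, map_sub, map_mul, map_mul, constantCoeff_lser,
    constantCoeff_lser, constantCoeff_lser, sub_eq_self]
  cases s
  · rw [gen_plus_zero (hlt j), mul_zero]
  · rw [gen_minus_zero (hlt i), zero_mul, zero_mul]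

theorem rtt_redSeries {q : K} (hq : q ≠ 0) {r n : ℕ} (h : r + 1 = n) {s s' : Sgn}
    {z z' : URbar q n} (M : SeriesModel K s s' z z')
    (hrel : ∀ i k j l a b,
      rttLeft q n z (zser s (lser q s)) (zser s' (lser q s')) i k j l a b =
        rttRight q n z' (zser s (lser q s)) (zser s' (lser q s')) i k j l a b)
    (i k j l : Fin (2 * r)) (a b : ℤ) :
    rttLeft q r z (zser s (redSeries q h s)) (zser s' (redSeries q h s')) i k j l a b =
      rttRight q r z' (zser s (redSeries q h s)) (zser s' (redSeries q h s')) i k j l a b := by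
  obtain ⟨c, hc, hc'⟩ := exists_firstEntry_inverse q h s
  obtain ⟨d, hd, hd'⟩ := exists_firstEntry_inverse q h s'
  exact M.rtt_reduce hq h (lser q s) (lser q s') hc' hc hd' hd hrel _ _
    (fun i j => schur_one (leadingBlock_isUnit q h s) hc _ _)
    (fun i j => schur_one (leadingBlock_isUnit q h s') hd _ _) i k j l a b

theorem redGen_rel {q : K} (hq : q ≠ 0) {r n : ℕ} (h : r + 1 = n)
    ⦃x y : FreeAlgebra K (Gen r)⦄ (hxy : Rel q r x y) :
    FreeAlgebra.lift K (redGen q h) x = FreeAlgebra.lift K (redGen q h) y := by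
  have hlt : ∀ {i j : Fin (2 * r)}, i < j → shiftIdx h i < shiftIdx h j := fun {i j} hij => by
    simp only [Fin.lt_def] at hij ⊢
    exact Nat.add_lt_add_left hij 1
  have hrtt := fun s s' hs => map_rtt_fell (FreeAlgebra.lift K (redGen q h)) q s s' hs
    (redSeries q h) fun s i j a => lift_redGen q h _
  induction hxy with
  | qHalf_mul_inv => simp only [map_mul, map_one, lift_redGen, redGen, qHalf_mul_qHalfInv]
  | qHalf_inv_mul => simp only [map_mul, map_one, lift_redGen, redGen, qHalfInv_mul_qHalf]
  | qHalf_central g => simp only [map_mul, lift_redGen q h Gen.qHalf, redGen, (qHalf_commute _).eq]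
  | plus_zero i j hij =>
    rw [lift_redGen, redGen, coeff_zero_redSeries, gen_plus_zero (hlt hij), map_zero]
  | minus_zero i j hij =>
    rw [lift_redGen, redGen, coeff_zero_redSeries, gen_minus_zero (hlt hij), map_zero]
  | middle i j hi hj =>
    simp only [map_mul, map_one, lift_redGen, redGen, coeff_zero_redSeries]
    have := mk_rel (q := q) (.middle (shiftIdx h i) (shiftIdx h j)
      (by simp only [shiftIdx]; omega) (by simp only [shiftIdx]; omega))
    simpa [gen] using this
  | plus_mul_minus i =>
    simp only [map_mul, map_one, lift_redGen, redGen, coeff_zero_redSeries, gen_plus_mul_minus]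
  | minus_mul_plus i =>
    simp only [map_mul, map_one, lift_redGen, redGen, coeff_zero_redSeries, gen_minus_mul_plus]
  | rtt_same s i k j l a b =>
    obtain ⟨h1, h2⟩ := hrtt s s (by cases s <;> simp) 1 i k j l a b
    rw [h1, h2, map_one]
    cases s
    · exact rtt_redSeries hq h plusModel (rtt_same_lser _) i k j l a b
    · exact rtt_redSeries hq h minusModel (rtt_same_lser _) i k j l a b
  | rtt_mixed i k j l a b =>
    have h1 := (hrtt .plus .minus (Or.inl rfl) (fgen K .qHalf ^ 2) i k j l a b).1
    have h2 := (hrtt .plus .minus (Or.inl rfl) (fgen K .qHalfInv ^ 2) i k j l a b).2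
    rw [map_pow, lift_redGen] at h1 h2
    rw [h1, h2]
    exact rtt_redSeries hq h
      (mixedModel _ _ fun x => (qHalfInv_commute x).pow_left 2) rtt_mixed_lser i k j l a b

theorem exists_isReduction_one {q : K} (hq : q ≠ 0) {r n : ℕ} (h : r + 1 = n) :
    ∃ ψ : URbar q r →ₐ[K] URbar q n, IsReduction q h ψ := by
  let ψ : URbar q r →ₐ[K] URbar q n :=
    RingQuot.liftAlgHom K ⟨FreeAlgebra.lift K (redGen q h), redGen_rel hq h⟩
  have hψ : ∀ g, ψ (gen q g) = redGen q h g := fun g =>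
    (RingQuot.liftAlgHom_mkAlgHom_apply K _ (redGen_rel hq h) _).trans (lift_redGen q h g)
  exact ⟨ψ, (isReduction_iff h ψ).mpr ⟨hψ _, fun s i j a => hψ _⟩⟩

/-- One pair is removed at a time, through U(R̄^{[r]}) → U(R̄^{[r+1]}) → U(R̄^{[n]}), so the
R-matrix computation is needed only for m = 1. -/
theorem exists_isReduction {q : K} (hq : q ≠ 0) (m : ℕ) {r n : ℕ} (h : r + m = n) :
    ∃ ψ : URbar q r →ₐ[K] URbar q n, IsReduction q h ψ := by
  induction m generalizing r with
  | zero =>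
    subst h
    exact ⟨_, isReduction_id (n := r) rfl⟩
  | succ m ih =>
    obtain ⟨ψ₁, h₁⟩ := exists_isReduction_one hq (r := r) rfl
    obtain ⟨ψ₂, h₂⟩ := ih (r := r + 1) (by omega)
    exact ⟨_, isReduction_comp h h₁ h₂⟩

end Relations

end TwistedRTT

end

/-! ### The theorem over ℂ(q), with q the variable of the rational function field. -/

theorem mainTheorem5 :
    -- the quasideterminants are defined, and they define a (unique) homomorphism
    (∀ (r m n : ℕ) (_ : 1 ≤ r) (h : r + m = n),
      (∀ s : TwistedRTT.Sgn,
        IsUnit (TwistedRTT.leadingBlock (RatFunc.X : RatFunc ℂ) h s)) ∧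
      ∃! ψ : TwistedRTT.URbar (RatFunc.X : RatFunc ℂ) r →ₐ[RatFunc ℂ]
          TwistedRTT.URbar (RatFunc.X : RatFunc ℂ) n,
        TwistedRTT.IsReduction RatFunc.X h ψ) ∧
    -- compatibility: with `p = n - l - m` and `r = n - l`
    (∀ (p r n l m : ℕ) (_ : 1 ≤ p) (hm : p + m = r) (hl : r + l = n) (hlm : p + (l + m) = n)
      (ψm : TwistedRTT.URbar (RatFunc.X : RatFunc ℂ) p →ₐ[RatFunc ℂ]
          TwistedRTT.URbar (RatFunc.X : RatFunc ℂ) r)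
      (ψl : TwistedRTT.URbar (RatFunc.X : RatFunc ℂ) r →ₐ[RatFunc ℂ]
          TwistedRTT.URbar (RatFunc.X : RatFunc ℂ) n)
      (ψlm : TwistedRTT.URbar (RatFunc.X : RatFunc ℂ) p →ₐ[RatFunc ℂ]
          TwistedRTT.URbar (RatFunc.X : RatFunc ℂ) n),
      TwistedRTT.IsReduction RatFunc.X hm ψm → TwistedRTT.IsReduction RatFunc.X hl ψl →
      TwistedRTT.IsReduction RatFunc.X hlm ψlm → ψl.comp ψm = ψlm) := by
  refine ⟨fun r m n _ h => ⟨TwistedRTT.leadingBlock_isUnit _ h, ?_⟩,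
    fun p r n l m _ hm hl hlm ψm ψl ψlm h₁ h₂ h₃ => ?_⟩
  · obtain ⟨ψ, hψ⟩ := TwistedRTT.exists_isReduction (K := RatFunc ℂ) (q := RatFunc.X) RatFunc.X_ne_zero m h
    exact ⟨ψ, hψ, fun ψ' hψ' => hψ'.unique hψ⟩
  · exact (TwistedRTT.isReduction_comp hlm h₁ h₂).unique h₃
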